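/- Fix real $\beta>0$ and $c\ge 1$, and let $s_c=(c-1)/2$. For $n\ge1$ let $(\lambda_1,\dots,\lambda_n)\in(0,\infty)^n$ have the probability density $$\frac1{\mathcal Z_n}\exp\Big(-\beta\Big[-\tfrac12\sum_{i\ne j}\ln|\lambda_i-\lambda_j|+n\sum_k\big(\tfrac{\lambda_k}{2}-\alpha\ln\lambda_k\big)\Big]\Big),\qquad \alpha=\frac{c-1}2+\frac1{2n}-\frac1{\beta n}$$ (the Wishart, or $\beta$-Laguerre, ensemble), with $\mathcal Z_n$ the normalization constant, and put $$T=\frac1n\sum_i\lambda_i,\qquad H=\frac1n\sum_i\ln\lambda_i,\qquad L=T-H-1 .$$ Let $\phi(x)=-\tfrac32x+x^2\ln(-2x)-\tfrac{(1-2x)^2}{4}\ln(1-2x)$ for $x\le 0$ (with $0^2\ln 0=0$), $J_H(s)=\phi(s-s_c)-\phi(-s_c)$, $J_T(w)=\tfrac c2\ln(1+2w)$ and $J(s,w)=J_H(s)+J_T(w)-s\ln(1+2w)$. Denote by $\langle\cdot\rangle$ the average and by $C_\ell(X)$ the $\ell$-th cumulant of $X$ under the law above, and set $\omega_\beta(n,\ell)=(2/\beta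 n^2)^{\ell-1}$. (i) The law is well defined ($0<\mathcal Z_n<\infty$). For every $s>-1/2$ with $s\ge -s_c$, the Laplace transform $\langle e^{-\beta n^2sL}\rangle$ is finite for all $n\ge1$, and the cumulant generating function of $L$ is $$J_L(s):=-\lim_{n\to\infty}\frac1{\beta n^2}\ln\big\langle e^{-\beta n^2sL}\big\rangle=J(-s,s)-s .$$ (ii) Let $c>1$. Then $J_L$, $J_T$, $J_H$ are analytic at $0$; for every $n\ge1$ the functions $u\mapsto\ln\langle e^{uX}\rangle$, $X\in\{L,T,H\}$, are analytic at $0$; and the cumulants at leading order are obtained by differentiation: for every $\ell\ge1$ and $X\in\{L,T,H\}$, $$\lim_{n\to\infty}(-\beta n^2)^{\ell-1}C_\ell(X)=J_X^{(\ell)}(0).$$ Moreover, for every $\ell\ge1$, as $n\to\infty$, $$C_\ell(L)=C_\ell(T)+(-1)^\ell C_\ell(H)+\delta C_\ell+o\big(\omega_\beta(n,\ell)\big),$$ where $\delta C_1=-1$ and $\delta C_\ell=\omega_\beta(n,\ell)\,\dfrac{\ell!}{1-\ell}$ for $\ell\ge2$. (iii) Let $c>1$ and $\ell_c=c+(c-1)\ln(c-1)-c\ln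 c$. Then $L$ is square integrable for every $n\ge1$ and $$\lim_{n\to\infty}\langle L\rangle=\ell_c,\qquad \lim_{n\to\infty}\frac{\mathrm{var}(L)}{\omega_\beta(n,2)}=c+\ln\frac{c}{c-1}-2 ,$$ and the typical fluctuations of $L$ are on a region of order $1/n$ around $\ell_c$: for every $\varepsilon>0$ there is a $K$ such that $\Pr\big(|L-\ell_c|>K/n\big)\le\varepsilon$ for all $n\ge1$. -/

import Mathlib

open MeasureTheory ProbabilityTheory Filter Topology

noncomputable section

namespace Wishart

/-- The parameter `α = (c - 1)/2 + 1/(2n) - 1/(βn)` of the external potential. -/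
def alpha (β c : ℝ) (n : ℕ) : ℝ :=
  (c - 1) / 2 + 1 / (2 * (n : ℝ)) - 1 / (β * (n : ℝ))

/-- The external potential `V(x) = x/2 - α ln x`, used only for `x > 0`. -/
def potential (β c : ℝ) (n : ℕ) (x : ℝ) : ℝ :=
  x / 2 - alpha β c n * Real.log x

/-- The energy `E[x] = -(1/2) ∑_{i ≠ j} ln |x i - x j| + n ∑ₖ V(x k)`. (Configurations with
coinciding coordinates, where the true energy is infinite, form a Lebesgue-null set.) -/
def energy (β c : ℝ) (n : ℕ) (x : Fin n → ℝ) : ℝ :=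
  -(1 / 2) * (∑ i, ∑ j ∈ Finset.univ.erase i, Real.log |x i - x j|)
    + (n : ℝ) * ∑ k, potential β c n (x k)

/-- The unnormalized Gibbs measure `exp(-β E[x]) dx` on the positive orthant. The potential is
infinite, so there is no mass, outside of it. -/
def gibbs (β c : ℝ) (n : ℕ) : Measure (Fin n → ℝ) :=
  ((volume : Measure (Fin n → ℝ)).restrict {x | ∀ i, 0 < x i}).withDensity
    (fun x => ENNReal.ofReal (Real.exp (-(β * energy β c n x))))

/-- The law of the eigenvalues: the Gibbs measure divided by its total mass (the partition
function). -/
def law (β c : ℝ) (n : ℕ) : Measure (Fin n → ℝ) :=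
  (gibbs β c n Set.univ)⁻¹ • gibbs β c n

/-- The scaled log-determinant `H`. -/
def logDet (n : ℕ) (x : Fin n → ℝ) : ℝ := (1 / (n : ℝ)) * ∑ i, Real.log (x i)

/-- The scaled trace (total variance) `T`. -/
def totalVar (n : ℕ) (x : Fin n → ℝ) : ℝ := (1 / (n : ℝ)) * ∑ i, x i

/-- The likelihood ratio `L = T - H - 1`. -/
def likelihoodRatio (n : ℕ) (x : Fin n → ℝ) : ℝ := totalVar n x - logDet n x - 1

/-- The `ℓ`-th cumulant of `X` under `μ`: the `ℓ`-th derivative at `0` of `u ↦ ln E[exp(u X)]`. -/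
def cumulant {Ω : Type*} [MeasurableSpace Ω] (ℓ : ℕ) (X : Ω → ℝ) (μ : Measure Ω) : ℝ :=
  iteratedDeriv ℓ (cgf X μ) 0

/-- The critical value `s_c = (c - 1)/2`. -/
def sc (c : ℝ) : ℝ := (c - 1) / 2

/-- `φ(x) = -(3/2) x + x² ln(-2x) - ((1 - 2x)²/4) ln(1 - 2x)` for `x ≤ 0`
(with `0² ln 0 = 0`, which is the continuous extension). -/
def phi (x : ℝ) : ℝ :=
  -(3 / 2) * x + x ^ 2 * Real.log (-2 * x) - (1 - 2 * x) ^ 2 / 4 * Real.log (1 - 2 * x)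

/-- The generating function of the cumulants of `H`. -/
def JH (c s : ℝ) : ℝ := phi (s - sc c) - phi (-sc c)

/-- The generating function of the cumulants of `T`. -/
def JT (c w : ℝ) : ℝ := c / 2 * Real.log (1 + 2 * w)

/-- The joint cumulant generating function of `(H, T)`. -/
def J (c s w : ℝ) : ℝ := JH c s + JT c w - s * Real.log (1 + 2 * w)

/-- The cumulant generating function of `L`. -/
def JL (c s : ℝ) : ℝ := J c (-s) s - s

/-- The scale `ω_β(n, ℓ) = (2/(β n²))^(ℓ - 1)`, for `ℓ ≥ 1`. -/
def omega (β : ℝ) (n ℓ : ℕ) : ℝ := (2 / (β * (n : ℝ) ^ 2)) ^ (ℓ - 1)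

/-- The correction `δC_ℓ = ω_β(n, ℓ) (ℓ!/(1 - ℓ)) θ(ℓ - 1) - δ_{ℓ,1}`, where the Heaviside factor
selects `ℓ > 1`. -/
def deltaC (β : ℝ) (n ℓ : ℕ) : ℝ :=
  omega β n ℓ * (if 1 < ℓ then (ℓ.factorial : ℝ) / (1 - (ℓ : ℝ)) else 0)
    - (if ℓ = 1 then 1 else 0)

/-- The limiting mean `c + (c - 1) ln(c - 1) - c ln c` of `L`. -/
def meanL (c : ℝ) : ℝ := c + (c - 1) * Real.log (c - 1) - c * Real.log c

end Wishart

end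

noncomputable section

namespace Wishart

/-! Everything rests on an exact formula for the joint Laplace transform of `(H, T)` at finite `n`.
The density is a Laguerre weight `∏ x_i ^ (a - 1) exp (-b x_i)` times `∏_{i < j} |x_i - x_j| ^ (2γ)`
with `γ = β / 2`. Multiplying it by `exp (-β n² (s H + w T))` only shifts `a` and `b`, so the
transform is a ratio of two partition functions. The dependence on `b` follows from scaling. The
dependence on `a` follows from Aomoto's integration by parts, which gives `Z (a + 1) = ∏ j < n, (a +
γ j) * Z a` (`partitionFunction_add_one`). Since `ln Z` is convex in `a`, Krull's uniqueness theorem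
(`krull_uniqueness`), in the manner of Bohr and Mollerup, forces `ln Z a = ∑ j < n, ln Γ (a + γ j) +
const` (`log_partitionFunction_sub`). Only ratios occur, so the constant of the Selberg-type
integral is never needed.

The resulting generating function of `L` at finite `n` is `J_T s + finiteJH (-s) + (s ln (1 + 2 s) -
s)`. Only `finiteJH`, a sum of `ln Γ`, depends on `n`. Hence the cumulants of `T` are exact, and the
decomposition of the cumulants of `L` holds without error, with `δC_ℓ` coming from the last term.

Stirling's formula and a Riemann sum give `finiteJH → J_H` pointwise, up to and including `s = s_c`
(`tendsto_finiteJH`). To differentiate this limit, note that `y ↦ ln Γ (-y)` has nonnegative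
derivatives of every order at least two on `y < 0`, by Gauss's limit formula. All derivatives of
`-finiteJH` are therefore convex, and pointwise convergence of convex functions passes to
derivatives (`HigherDerivNonneg.tendsto_iteratedDeriv`).

The mean is an average of digamma values. The bounds `ln x - 1/x ≤ ψ x ≤ ln x` give its limit with
rate `1/n`. Together with the limit of the variance and Chebyshev's inequality this yields the
fluctuation bound. -/

/-! ### Convex functions: convergence of derivatives -/

/-- Pointwise convergence of differentiable convex functions to a differentiable function entails
convergence of the derivatives. -/
theorem tendsto_deriv_of_convexOn {U : Set ℝ} (hU : IsOpen U) {f : ℕ → ℝ → ℝ} {g : ℝ → ℝ}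
    (hf : ∀ n, ConvexOn ℝ U (f n)) (hd : ∀ n, ∀ x ∈ U, DifferentiableAt ℝ (f n) x)
    (hlim : ∀ x ∈ U, Tendsto (fun n => f n x) atTop (𝓝 (g x)))
    {x : ℝ} (hx : x ∈ U) (hg : DifferentiableAt ℝ g x) :
    Tendsto (fun n => deriv (f n) x) atTop (𝓝 (deriv g x)) := by
  have hslope : Tendsto (slope g x) (𝓝[≠] x) (𝓝 (deriv g x)) := hg.hasDerivAt.tendsto_slope
  have hlimslope : ∀ y ∈ U, Tendsto (fun n => slope (f n) x y) atTop (𝓝 (slope g x y)) := by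
    intro y hy
    simp only [slope_def_field]
    exact ((hlim y hy).sub (hlim x hx)).div_const _
  refine tendsto_order.2 ⟨fun a ha => ?_, fun a ha => ?_⟩
  -- A chord of `g` on the left of `x` has slope above `a`; the same chord of `f n` eventually does
  -- too, and by convexity it bounds the derivative at `x` from below. Chords on the right give the
  -- upper bound.
  · have h1 : ∀ᶠ y in 𝓝[<] x, a < slope g x y ∧ y ∈ U ∧ y < x := by
      have hle : 𝓝[<] x ≤ 𝓝[≠] x := nhdsWithin_mono _ fun y hy => ne_of_lt hy
      filter_upwards [(hslope.mono_left hle).eventually (lt_mem_nhds ha),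
        nhdsWithin_le_nhds (hU.mem_nhds hx), self_mem_nhdsWithin] with y h1 h2 h3
      exact ⟨h1, h2, h3⟩
    obtain ⟨y, hy1, hyU, hyx⟩ := h1.exists
    filter_upwards [(hlimslope y hyU).eventually (lt_mem_nhds hy1)] with n hn
    refine hn.trans_le ?_
    rw [slope_comm]
    exact (hf n).slope_le_deriv hyU hx hyx (hd n x hx)
  · have h1 : ∀ᶠ y in 𝓝[>] x, slope g x y < a ∧ y ∈ U ∧ x < y := by
      have hle : 𝓝[>] x ≤ 𝓝[≠] x := nhdsWithin_mono _ fun y hy => ne_of_gt hy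
      filter_upwards [(hslope.mono_left hle).eventually (gt_mem_nhds ha),
        nhdsWithin_le_nhds (hU.mem_nhds hx), self_mem_nhdsWithin] with y h1 h2 h3
      exact ⟨h1, h2, h3⟩
    obtain ⟨y, hy1, hyU, hyx⟩ := h1.exists
    filter_upwards [(hlimslope y hyU).eventually (gt_mem_nhds hy1)] with n hn
    exact ((hf n).deriv_le_slope hx hyU hyx (hd n x hx)).trans_lt hn

/-- Analytic functions all of whose derivatives of order at least two are nonnegative. -/
structure HigherDerivNonneg (f : ℝ → ℝ) (U : Set ℝ) : Prop where
  analytic : AnalyticOnNhd ℝ f U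
  nonneg : ∀ k, 2 ≤ k → ∀ x ∈ U, 0 ≤ iteratedDeriv k f x

theorem analyticOnNhd_iteratedDeriv {f : ℝ → ℝ} {U : Set ℝ} (h : AnalyticOnNhd ℝ f U) (k : ℕ) :
    AnalyticOnNhd ℝ (iteratedDeriv k f) U := by
  rw [iteratedDeriv_eq_iterate]
  exact h.iterated_deriv k

namespace HigherDerivNonneg

variable {U : Set ℝ} {f : ℝ → ℝ}

/-- The second derivative of the `k`-th derivative has order `k + 2 ≥ 2`, so a sign condition from
order two on covers every `k`, including `k = 0`. -/
theorem convexOn_iteratedDeriv (h : HigherDerivNonneg f U) (hc : Convex ℝ U) (k : ℕ) :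
    ConvexOn ℝ U (iteratedDeriv k f) := by
  have ha := analyticOnNhd_iteratedDeriv h.analytic k
  refine convexOn_of_deriv2_nonneg' hc ha.differentiableOn ?_ ?_
  · exact ha.deriv.differentiableOn
  · intro x hx
    have : deriv^[2] (iteratedDeriv k f) x = iteratedDeriv (k + 2) f x := by
      simp [iteratedDeriv_succ]
    rw [this]
    exact h.nonneg (k + 2) (by omega) x hx

/-- Under the sign condition, pointwise convergence entails convergence of all derivatives. -/
theorem tendsto_iteratedDeriv {f : ℕ → ℝ → ℝ} {g : ℝ → ℝ} (hU : IsOpen U) (hc : Convex ℝ U)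
    (hf : ∀ n, HigherDerivNonneg (f n) U) (hg : AnalyticOnNhd ℝ g U)
    (hlim : ∀ x ∈ U, Tendsto (fun n => f n x) atTop (𝓝 (g x))) (k : ℕ) :
    ∀ x ∈ U, Tendsto (fun n => iteratedDeriv k (f n) x) atTop (𝓝 (iteratedDeriv k g x)) := by
  induction k with
  | zero => simpa using hlim
  | succ k ih =>
    intro x hx
    simp only [iteratedDeriv_succ]
    exact tendsto_deriv_of_convexOn hU (fun n => (hf n).convexOn_iteratedDeriv hc k)
      (fun n y hy => (analyticOnNhd_iteratedDeriv (hf n).analytic k y hy).differentiableAt)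
      ih hx (analyticOnNhd_iteratedDeriv hg k x hx).differentiableAt

/-- The sign condition passes to analytic pointwise limits. -/
theorem of_tendsto {f : ℕ → ℝ → ℝ} {g : ℝ → ℝ} (hU : IsOpen U) (hc : Convex ℝ U)
    (hf : ∀ n, HigherDerivNonneg (f n) U) (hg : AnalyticOnNhd ℝ g U)
    (hlim : ∀ x ∈ U, Tendsto (fun n => f n x) atTop (𝓝 (g x))) : HigherDerivNonneg g U where
  analytic := hg
  nonneg k hk x hx := ge_of_tendsto' (tendsto_iteratedDeriv hU hc hf hg hlim k x hx)
    fun n => (hf n).nonneg k hk x hx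

theorem affine (a b : ℝ) (U : Set ℝ) : HigherDerivNonneg (fun x => a * x + b) U where
  analytic x _ := by fun_prop
  nonneg k hk x _ := by
    obtain ⟨m, rfl⟩ := Nat.exists_eq_add_of_le' hk
    have h1 : deriv (fun x : ℝ => a * x + b) = fun _ => a := by
      ext y; simp
    rw [iteratedDeriv_succ', iteratedDeriv_succ', h1]
    simp

theorem sum {ι : Type*} (s : Finset ι) {f : ι → ℝ → ℝ}
    (hf : ∀ i ∈ s, HigherDerivNonneg (f i) U) : HigherDerivNonneg (fun x => ∑ i ∈ s, f i x) U where
  analytic x hx := Finset.analyticAt_fun_sum s fun i hi => (hf i hi).analytic x hx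
  nonneg k hk x hx := by
    rw [iteratedDeriv_fun_sum fun i hi => ((hf i hi).analytic x hx).contDiffAt]
    exact Finset.sum_nonneg fun i hi => (hf i hi).nonneg k hk x hx

theorem add {g : ℝ → ℝ} (hf : HigherDerivNonneg f U) (hg : HigherDerivNonneg g U) :
    HigherDerivNonneg (fun x => f x + g x) U where
  analytic x hx := (hf.analytic x hx).add (hg.analytic x hx)
  nonneg k hk x hx := by
    rw [iteratedDeriv_fun_add (hf.analytic x hx).contDiffAt (hg.analytic x hx).contDiffAt]
    exact add_nonneg (hf.nonneg k hk x hx) (hg.nonneg k hk x hx)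

theorem const_mul {a : ℝ} (ha : 0 ≤ a) (hf : HigherDerivNonneg f U) :
    HigherDerivNonneg (fun x => a * f x) U where
  analytic x hx := analyticAt_const.mul (hf.analytic x hx)
  nonneg k hk x hx := by
    rw [iteratedDeriv_const_mul_field]
    exact mul_nonneg ha (hf.nonneg k hk x hx)

end HigherDerivNonneg

theorem iteratedDeriv_comp_mul_left (f : ℝ → ℝ) (a : ℝ) (k : ℕ) :
    iteratedDeriv k (fun x => f (a * x)) = fun x => a ^ k * iteratedDeriv k f (a * x) := by
  induction k with
  | zero => simp
  | succ k ih =>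
    ext x
    rw [iteratedDeriv_succ, ih, deriv_const_mul_field, deriv_comp_mul_left a, iteratedDeriv_succ,
      smul_eq_mul]
    ring

theorem HigherDerivNonneg.comp_affine {f : ℝ → ℝ} {U V : Set ℝ} (hf : HigherDerivNonneg f U)
    {a : ℝ} (b : ℝ) (ha : 0 ≤ a) (h : ∀ x ∈ V, a * x + b ∈ U) :
    HigherDerivNonneg (fun x => f (a * x + b)) V where
  analytic x hx := by
    have := hf.analytic _ (h x hx)
    exact this.comp (f := fun x => a * x + b) (by fun_prop)
  nonneg k hk x hx := by
    rw [iteratedDeriv_comp_mul_left (fun y => f (y + b)) a k, iteratedDeriv_comp_add_const]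
    exact mul_nonneg (pow_nonneg ha _) (hf.nonneg k hk _ (h x hx))

/-! ### Krull's uniqueness theorem for difference equations -/

/-- By convexity the slope over `[a, a + x]` lies between those over `[a - 1, a]` and `[a, a + 1]`,
which the difference equation identifies as `h (a - 1)` and `h a`. -/
theorem mul_le_sub_le_mul_of_convexOn {g h : ℝ → ℝ} (hg : ConvexOn ℝ (Set.Ioi 0) g)
    (hgh : ∀ x, 0 < x → g (x + 1) = g x + h x) {a x : ℝ} (ha : 1 < a) (hx : 0 ≤ x) (hx1 : x ≤ 1) :
    x * h (a - 1) ≤ g (a + x) - g a ∧ g (a + x) - g a ≤ x * h a := by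
  have e1 := hgh a (by linarith)
  have e2 := hgh (a - 1) (by linarith)
  rw [sub_add_cancel] at e2
  rcases hx.eq_or_lt with rfl | hx
  · simp
  constructor
  · have := hg.slope_mono_adjacent (x := a - 1) (y := a) (z := a + x) (by simp; linarith)
      (by simp; linarith) (by linarith) (by linarith)
    rw [e2, show a - (a - 1) = 1 by ring, show a + x - a = x by ring, div_one, le_div_iff₀ hx]
      at this
    linarith
  · have := hg.2 (Set.mem_Ioi.2 (by linarith : 0 < a)) (Set.mem_Ioi.2 (by linarith : 0 < a + 1))
      (by linarith : 0 ≤ 1 - x) hx.le (by ring)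
    simp only [smul_eq_mul] at this
    rw [show (1 - x) * a + x * (a + 1) = a + x by ring, e1] at this
    linarith

/-- Two convex solutions on `(0, ∞)` of the difference equation `g (x + 1) - g x = h x` differ by a
constant if `h (x + 1) - h x → 0`. -/
theorem krull_uniqueness {g₁ g₂ h : ℝ → ℝ} (hg₁ : ConvexOn ℝ (Set.Ioi 0) g₁)
    (hg₂ : ConvexOn ℝ (Set.Ioi 0) g₂) (h₁ : ∀ x, 0 < x → g₁ (x + 1) = g₁ x + h x)
    (h₂ : ∀ x, 0 < x → g₂ (x + 1) = g₂ x + h x)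
    (hh : Tendsto (fun x => h (x + 1) - h x) atTop (𝓝 0)) {a b : ℝ} (ha : 0 < a) (hb : 0 < b) :
    g₁ a - g₂ a = g₁ b - g₂ b := by
  -- The difference of two solutions has period one, so it may be examined arbitrarily far out.
  have per : ∀ (m : ℕ) (x : ℝ), 0 < x → g₁ (x + m) - g₂ (x + m) = g₁ x - g₂ x := by
    intro m x hx
    induction m with
    | zero => simp
    | succ m ih =>
      have hm : 0 < x + m := by positivity
      push_cast
      rw [← add_assoc, h₁ _ hm, h₂ _ hm]
      linarith
  -- Far out, the increments of both solutions over a length `x ≤ 1` lie in the same window, whose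
  -- width tends to zero by `hh`.
  have close : ∀ a x : ℝ, 0 < a → 0 ≤ x → x ≤ 1 → g₁ (a + x) - g₂ (a + x) = g₁ a - g₂ a := by
    intro a x ha hx hx1
    have hlim : Tendsto (fun m : ℕ => x * (h (a + (m : ℝ) + 1 + 1) - h (a + (m : ℝ) + 1))) atTop
        (𝓝 0) := by
      have : Tendsto (fun m : ℕ => a + (m : ℝ) + 1) atTop atTop :=
        tendsto_atTop_add_const_right _ _ (tendsto_atTop_add_const_left _ _
          tendsto_natCast_atTop_atTop)
      simpa using (hh.comp this).const_mul x
    have hb : ∀ m : ℕ, |(g₁ (a + x) - g₂ (a + x)) - (g₁ a - g₂ a)|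
        ≤ x * (h (a + (m : ℝ) + 1 + 1) - h (a + (m : ℝ) + 1)) := by
      intro m
      have p1 := per (m + 2) (a + x) (by linarith)
      have p2 := per (m + 2) a ha
      have hm : (0 : ℝ) ≤ m := m.cast_nonneg
      have k1 := mul_le_sub_le_mul_of_convexOn hg₁ h₁ (a := a + (m + 2)) (x := x) (by linarith) hx hx1
      have k2 := mul_le_sub_le_mul_of_convexOn hg₂ h₂ (a := a + (m + 2)) (x := x) (by linarith) hx hx1
      push_cast at p1 p2
      rw [show a + x + ((m : ℝ) + 2) = a + (m + 2) + x by ring] at p1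
      rw [show a + (m : ℝ) + 1 + 1 = a + (m + 2) by ring,
        show a + (m : ℝ) + 1 = a + (m + 2) - 1 by ring, abs_le]
      constructor <;> linarith [k1.1, k1.2, k2.1, k2.2]
    have := ge_of_tendsto' hlim hb
    have := abs_nonpos_iff.1 this
    linarith
  have main : ∀ a b : ℝ, 0 < a → a ≤ b → g₁ a - g₂ a = g₁ b - g₂ b := by
    intro a b ha hab
    have e : b = a + Int.fract (b - a) + (⌊b - a⌋₊ : ℝ) := by
      have := Int.floor_add_fract (b - a)
      rw [natCast_floor_eq_intCast_floor (by linarith : 0 ≤ b - a)]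
      linarith
    have hf := Int.fract_nonneg (b - a)
    rw [e, per _ _ (by linarith), close a _ ha hf (Int.fract_lt_one _).le]
  rcases le_total a b with hab | hab
  · exact main a b ha hab
  · exact (main b a hb hab).symm

/-! ### Riemann sums -/

/-- The derivative is required only in the open interval and continuity on the closed one: this
admits `u ln u` with `t = 0`, which is the boundary case `s = s_c`. -/
theorem tendsto_riemann_sum {F f : ℝ → ℝ} {t : ℝ} (hf : ContinuousOn f (Set.Icc t (t + 1)))
    (hF : ContinuousOn F (Set.Icc t (t + 1)))
    (hFf : ∀ x ∈ Set.Ioo t (t + 1), HasDerivAt F (f x) x) :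
    Tendsto (fun n : ℕ => (1 / (n : ℝ)) * ∑ j ∈ Finset.range n, f (t + ((j : ℝ) + 1) / n)) atTop
      (𝓝 (F (t + 1) - F t)) := by
  rw [Metric.tendsto_atTop]
  intro ε hε
  have huc := isCompact_Icc.uniformContinuousOn_of_continuous hf
  rw [Metric.uniformContinuousOn_iff] at huc
  obtain ⟨δ, hδ, hu⟩ := huc (ε / 2) (by linarith)
  obtain ⟨N, hN⟩ := exists_nat_gt (1 / δ)
  refine ⟨N + 1, fun n hn => ?_⟩
  have hnN : (N : ℝ) + 1 ≤ n := by exact_mod_cast hn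
  have hn0 : (0 : ℝ) < n := by have : (0 : ℝ) ≤ N := N.cast_nonneg
                               linarith
  have hnδ : 1 / (n : ℝ) < δ := by
    rw [div_lt_iff₀ hn0]
    rw [div_lt_iff₀ hδ] at hN
    nlinarith
  set p : ℕ → ℝ := fun j => t + (j : ℝ) / n with hp
  have tel : F (t + 1) - F t = ∑ j ∈ Finset.range n, (F (p (j + 1)) - F (p j)) := by
    rw [Finset.sum_range_sub (fun j => F (p j))]
    simp [hp, hn0.ne']
  have key : ∀ j ∈ Finset.range n,
      |(1 / (n : ℝ)) * f (t + ((j : ℝ) + 1) / n) - (F (p (j + 1)) - F (p j))|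
        ≤ (1 / n) * (ε / 2) := by
    intro j hj
    have hjn : ((j : ℝ) + 1) ≤ n := by exact_mod_cast Finset.mem_range.1 hj
    have hj0 : (0 : ℝ) ≤ j := j.cast_nonneg
    have e : p (j + 1) = p j + 1 / n := by simp only [hp]; push_cast; ring
    have hpos : 0 < 1 / (n : ℝ) := by positivity
    have hlow : t ≤ p j := by simp only [hp]; linarith [div_nonneg hj0 hn0.le]
    have hup : p (j + 1) ≤ t + 1 := by
      simp only [hp]; push_cast; linarith [(div_le_one hn0).2 hjn]
    -- The mean value theorem turns the increment of `F` into `f ξ / n`; uniform continuity then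
    -- compares `f ξ` with the value at the right endpoint.
    obtain ⟨ξ, hξ, hξ'⟩ := exists_hasDerivAt_eq_slope F f (a := p j) (b := p (j + 1))
      (by linarith) (hF.mono (Set.Icc_subset_Icc hlow hup))
      (fun x hx => hFf x ⟨by linarith [hx.1], by linarith [hx.2]⟩)
    have e2 : F (p (j + 1)) - F (p j) = (1 / n) * f ξ := by
      rw [hξ', e]
      field_simp
      ring
    rw [e2, ← mul_sub, abs_mul, abs_of_pos hpos]
    refine mul_le_mul_of_nonneg_left ?_ hpos.le
    have e3 : t + ((j : ℝ) + 1) / n = p (j + 1) := by simp [hp]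
    rw [e3]
    refine (hu _ ⟨by linarith, hup⟩ _ ⟨by linarith [hξ.1], by linarith [hξ.2]⟩ ?_).le
    rw [Real.dist_eq, abs_of_pos (by linarith [hξ.2])]
    linarith [hξ.1]
  rw [Real.dist_eq, tel, Finset.mul_sum, ← Finset.sum_sub_distrib]
  calc _ ≤ ∑ j ∈ Finset.range n, (1 / (n : ℝ)) * (ε / 2) :=
        (Finset.abs_sum_le_sum_abs _ _).trans (Finset.sum_le_sum key)
    _ = ε / 2 := by
        rw [Finset.sum_const, Finset.card_range, nsmul_eq_mul]
        field_simp
    _ < ε := by linarith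

/-! ### The logarithm of the Gamma function -/

/-- The function `ln Γ`. -/
def logGamma (x : ℝ) : ℝ := Real.log (Real.Gamma x)

theorem logGamma_add_one {x : ℝ} (hx : 0 < x) :
    logGamma (x + 1) = logGamma x + Real.log x := by
  rw [logGamma, Real.Gamma_add_one hx.ne', Real.log_mul hx.ne' (Real.Gamma_pos_of_pos hx).ne',
    add_comm, logGamma]

theorem convexOn_logGamma : ConvexOn ℝ (Set.Ioi 0) logGamma := Real.convexOn_log_Gamma

/-- Complex differentiability on the right half-plane gives analyticity of `Γ`, which restricts to
the real axis, where `Γ` is positive. -/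
theorem analyticOnNhd_logGamma : AnalyticOnNhd ℝ logGamma (Set.Ioi 0) := by
  intro x hx
  have hopen : IsOpen {z : ℂ | 0 < z.re} := isOpen_lt continuous_const Complex.continuous_re
  have hd : DifferentiableOn ℂ Complex.Gamma {z : ℂ | 0 < z.re} := by
    intro z hz
    refine (Complex.differentiableAt_Gamma z fun m h => ?_).differentiableWithinAt
    have h0 : (0 : ℝ) < z.re := hz
    rw [h] at h0
    simp only [Complex.neg_re, Complex.natCast_re] at h0
    linarith [(Nat.cast_nonneg m : (0 : ℝ) ≤ m)]
  have ha : AnalyticAt ℂ Complex.Gamma (x : ℂ) :=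
    hd.analyticAt (hopen.mem_nhds (by simpa using hx))
  have hr := ha.re_ofReal
  simp only [Complex.Gamma_ofReal, Complex.ofReal_re] at hr
  exact hr.log (Real.Gamma_pos_of_pos hx)

theorem differentiableAt_logGamma {x : ℝ} (hx : 0 < x) : DifferentiableAt ℝ logGamma x :=
  (analyticOnNhd_logGamma x hx).differentiableAt

/-- The `k`-th derivative is `(k - 1)! / (m - y) ^ k`. These functions are the building blocks of
Gauss's limit for `ln Γ (-y)`. -/
theorem higherDerivNonneg_neg_log_sub {m : ℝ} (hm : 0 ≤ m) :
    HigherDerivNonneg (fun y => -Real.log (m - y)) (Set.Iio 0) where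
  analytic y hy := by
    have hy : y < 0 := hy
    exact ((analyticAt_const.sub analyticAt_id).log (by simp; linarith)).neg
  nonneg k hk y hy := by
    have hy : y < 0 := hy
    obtain ⟨k, rfl⟩ := Nat.exists_eq_add_of_le' (by omega : 1 ≤ k)
    have h1 : deriv (fun y : ℝ => -Real.log (m - y)) = fun y => ((-1) * y + m)⁻¹ := by
      ext z
      have h2 := deriv_comp_const_sub (f := Real.log) m z
      rw [deriv.fun_neg, h2, Real.deriv_log, neg_neg, neg_one_mul, neg_add_eq_sub]
    rw [iteratedDeriv_succ', h1, iteratedDeriv_eq_iterate, iter_deriv_inv_linear]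
    have h3 : ((-1 : ℝ)) ^ k * (k.factorial : ℝ) * (-1) ^ k * (-1 * y + m) ^ (-1 - (k : ℤ))
        = (k.factorial : ℝ) * (-1 * y + m) ^ (-1 - (k : ℤ)) := by
      rw [mul_right_comm ((-1 : ℝ) ^ k), ← mul_pow]; norm_num
    simp only [h3]
    have : 0 < -1 * y + m := by linarith
    positivity

/-- Gauss's formula presents `ln Γ (-y)` as the limit of an affine function plus `-∑ ln (m - y)`,
and the sign condition survives the limit. The reflection `y ↦ -y` turns the alternating signs of
the derivatives of `ln Γ` into constant ones. -/
theorem higherDerivNonneg_logGamma_neg :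
    HigherDerivNonneg (fun y => logGamma (-y)) (Set.Iio 0) := by
  refine HigherDerivNonneg.of_tendsto (f := fun n y => Real.BohrMollerup.logGammaSeq (-y) n)
    isOpen_Iio (convex_Iio 0) (fun n => ?_) (fun y hy => ?_) fun y hy => ?_
  · have h1 := HigherDerivNonneg.affine (-Real.log n) (Real.log (n.factorial)) (Set.Iio 0)
    have h2 := HigherDerivNonneg.sum (Finset.range (n + 1)) (f := fun (m : ℕ) y =>
      -Real.log ((m : ℝ) - y)) (U := Set.Iio 0)
      fun m _ => higherDerivNonneg_neg_log_sub m.cast_nonneg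
    convert h1.add h2 using 2 with y
    simp only [Real.BohrMollerup.logGammaSeq, Finset.sum_neg_distrib, neg_add_eq_sub]
    ring
  · exact (analyticOnNhd_logGamma (-y) (by simpa using hy)).fun_comp analyticAt_id.neg
  · exact Real.BohrMollerup.tendsto_log_gamma (by simpa using hy)

/-- The chord of `ln Γ` over `[x, x + 1]` has slope `ln x`, and convexity places it above the
derivative at `x`. -/
theorem deriv_logGamma_le {x : ℝ} (hx : 0 < x) : deriv logGamma x ≤ Real.log x := by
  have h := convexOn_logGamma.deriv_le_slope (x := x) (y := x + 1) hx
    (Set.mem_Ioi.2 (by linarith)) (by linarith) (differentiableAt_logGamma hx)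
  rwa [slope_def_field, logGamma_add_one hx, add_sub_cancel_left, add_sub_cancel_left,
    div_one] at h

/-- The same chord lies below the derivative at `x + 1`, which exceeds the derivative at `x` by `1 /
x`. -/
theorem le_deriv_logGamma {x : ℝ} (hx : 0 < x) : Real.log x - 1 / x ≤ deriv logGamma x := by
  have hx1 : 0 < x + 1 := by linarith
  have h := convexOn_logGamma.slope_le_deriv (x := x) (y := x + 1) hx
    (Set.mem_Ioi.2 hx1) (by linarith) (differentiableAt_logGamma hx1)
  rw [slope_def_field, logGamma_add_one hx, add_sub_cancel_left, add_sub_cancel_left,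
    div_one] at h
  have e : deriv logGamma (x + 1) = deriv logGamma x + x⁻¹ := by
    have h1 : (fun y => logGamma (y + 1)) =ᶠ[𝓝 x] fun y => logGamma y + Real.log y := by
      filter_upwards [lt_mem_nhds hx] with y hy using logGamma_add_one hy
    have h2 := h1.deriv_eq
    rwa [deriv_comp_add_const, deriv_fun_add (differentiableAt_logGamma hx)
      (Real.differentiableAt_log hx.ne'), Real.deriv_log] at h2
  rw [e] at h
  rw [one_div]
  linarith

/-- A crude form of Stirling's formula. -/
theorem abs_logGamma_sub_le {x : ℝ} (hx : 0 < x) :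
    |logGamma x - (x * Real.log x - x) - 1| ≤ |Real.log x| := by
  -- The two digamma bounds say that `r` decreases and `r + ln` increases. Both equal `1` at `1`, so
  -- `r x - 1` lies between `0` and `-ln x`.
  set r : ℝ → ℝ := fun x => logGamma x - (x * Real.log x - x) with hr
  have hder : ∀ y, 0 < y → HasDerivAt r (deriv logGamma y - Real.log y) y := by
    intro y hy
    have h1 := (differentiableAt_logGamma hy).hasDerivAt
    have h2 := ((Real.hasDerivAt_mul_log hy.ne').sub (hasDerivAt_id y))
    exact (h1.sub h2).congr_deriv (by ring)
  have hder' : ∀ y, 0 < y →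
      HasDerivAt (fun y => r y + Real.log y) (deriv logGamma y - Real.log y + y⁻¹) y :=
    fun y hy => (hder y hy).add (Real.hasDerivAt_log hy.ne')
  have anti : AntitoneOn r (Set.Ioi 0) := by
    refine antitoneOn_of_deriv_nonpos (convex_Ioi 0)
      (fun y hy => (hder y hy).continuousAt.continuousWithinAt)
      (fun y hy => ?_) (fun y hy => ?_)
    · rw [interior_Ioi] at hy
      exact (hder y hy).differentiableAt.differentiableWithinAt
    · rw [interior_Ioi] at hy
      rw [(hder y hy).deriv]
      linarith [deriv_logGamma_le hy]
  have mono : MonotoneOn (fun y => r y + Real.log y) (Set.Ioi 0) := by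
    refine monotoneOn_of_deriv_nonneg (convex_Ioi 0)
      (fun y hy => (hder' y hy).continuousAt.continuousWithinAt)
      (fun y hy => ?_) (fun y hy => ?_)
    · rw [interior_Ioi] at hy
      exact (hder' y hy).differentiableAt.differentiableWithinAt
    · rw [interior_Ioi] at hy
      rw [(hder' y hy).deriv]
      have := le_deriv_logGamma hy
      rw [one_div] at this
      linarith
  have h1 : r 1 = 1 := by simp [hr, logGamma]
  have h0 : (1 : ℝ) ∈ Set.Ioi 0 := Set.mem_Ioi.2 one_pos
  change |r x - 1| ≤ _
  rcases le_total 1 x with h | h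
  · have a1 := anti h0 (Set.mem_Ioi.2 hx) h
    have a2 := mono h0 (Set.mem_Ioi.2 hx) h
    simp only [Real.log_one, h1] at a1 a2
    rw [abs_of_nonneg (Real.log_nonneg h), abs_le]
    constructor <;> linarith
  · have a1 := anti (Set.mem_Ioi.2 hx) h0 h
    have a2 := mono (Set.mem_Ioi.2 hx) h0 h
    simp only [Real.log_one, h1] at a1 a2
    rw [abs_of_nonpos (Real.log_nonpos hx.le h), abs_le]
    constructor <;> linarith

/-! ### Integrals over the positive orthant -/

/-- Lebesgue measure on the positive orthant, as a product measure. -/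
def orthant (n : ℕ) : Measure (Fin n → ℝ) :=
  Measure.pi fun _ => (volume : Measure ℝ).restrict (Set.Ioi 0)

instance (n : ℕ) : SigmaFinite (orthant n) := by unfold orthant; infer_instance

theorem orthant_eq_restrict (n : ℕ) :
    orthant n = (volume : Measure (Fin n → ℝ)).restrict {x | ∀ i, 0 < x i} := by
  rw [orthant, ← Measure.restrict_pi_pi, ← volume_pi]
  congr 1
  ext x
  simp

theorem measurableSet_orthant (n : ℕ) : MeasurableSet {x : Fin n → ℝ | ∀ i, 0 < x i} := by
  simp only [Set.ofPred_forall]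
  exact MeasurableSet.iInter fun i => measurableSet_lt measurable_const (measurable_pi_apply i)

theorem ae_orthant_pos (n : ℕ) : ∀ᵐ x ∂orthant n, ∀ i, 0 < x i := by
  rw [orthant_eq_restrict]
  exact ae_restrict_mem (measurableSet_orthant n)

theorem ae_orthant_ne (n : ℕ) : ∀ᵐ x ∂orthant n, ∀ i j, i ≠ j → x i ≠ x j := by
  rw [orthant_eq_restrict]
  refine ae_restrict_of_ae ?_
  rw [ae_all_iff]
  intro i
  rw [ae_all_iff]
  intro j
  by_cases hij : i = j
  · simp [hij]
  let p : Submodule ℝ (Fin n → ℝ) :=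
    LinearMap.ker ((LinearMap.proj i : (Fin n → ℝ) →ₗ[ℝ] ℝ) - LinearMap.proj j)
  have hp : p ≠ ⊤ := by
    intro h
    have : Pi.single i (1 : ℝ) ∈ p := h ▸ Submodule.mem_top
    simp [p, LinearMap.mem_ker, Ne.symm hij] at this
  have h0 := Measure.addHaar_submodule (volume : Measure (Fin n → ℝ)) p hp
  filter_upwards [measure_eq_zero_iff_ae_notMem.1 h0] with x hx _ hxij
  refine hx ?_
  simp [p, LinearMap.mem_ker, hxij]

theorem measurePreserving_orthant_perm {n : ℕ} (σ : Equiv.Perm (Fin n)) :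
    MeasurePreserving (fun (x : Fin n → ℝ) i => x (σ i)) (orthant n) (orthant n) := by
  have h := measurePreserving_piCongrLeft
    (fun _ : Fin n => (volume : Measure ℝ).restrict (Set.Ioi 0)) σ.symm
  unfold orthant
  convert h using 1
  ext x i
  have := Equiv.piCongrLeft_apply_apply (fun _ : Fin n => ℝ) σ.symm x (σ i)
  simpa [MeasurableEquiv.coe_piCongrLeft] using this.symm

theorem integral_orthant_perm {n : ℕ} (σ : Equiv.Perm (Fin n)) {f : (Fin n → ℝ) → ℝ}
    (hf : Measurable f) : ∫ x, f (fun i => x (σ i)) ∂orthant n = ∫ x, f x ∂orthant n := by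
  have h := measurePreserving_orthant_perm σ
  rw [← h.map_eq, integral_map h.measurable.aemeasurable hf.aestronglyMeasurable, h.map_eq]

/-- The derivative of a function on `(0, ∞)` that vanishes at `0` and is integrable together with its
derivative has integral zero. -/
theorem integral_deriv_Ioi_eq_zero {g g' : ℝ → ℝ} (hd : ∀ t, 0 < t → HasDerivAt g (g' t) t)
    (hg : IntegrableOn g (Set.Ioi 0)) (hg' : IntegrableOn g' (Set.Ioi 0))
    (h0 : Tendsto g (𝓝[>] 0) (𝓝 0)) : ∫ t in Set.Ioi 0, g' t = 0 := by
  have hinf := tendsto_zero_of_hasDerivAt_of_integrableOn_Ioi hd hg' hg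
  -- The value of `g` at `0` is uncontrolled; replacing it by the limit `0` makes the function
  -- continuous up to the endpoint.
  have hd' : ∀ t ∈ Set.Ioi (0 : ℝ), HasDerivAt (Function.update g 0 0) (g' t) t := by
    intro t ht
    refine (hd t ht).congr_of_eventuallyEq ?_
    filter_upwards [lt_mem_nhds ht] with s hs
    rw [Function.update_of_ne hs.ne']
  have h := integral_Ioi_of_hasDerivAt_of_tendsto (f := Function.update g 0 0) (a := 0) (m := 0)
    ?_ hd' hg' ?_
  · simpa using h
  · rw [← Set.Ioi_union_left, continuousWithinAt_union]
    refine ⟨?_, by simp⟩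
    rw [ContinuousWithinAt, Function.update_self]
    refine h0.congr' ?_
    filter_upwards [self_mem_nhdsWithin] with s hs
    rw [Function.update_of_ne (ne_of_gt hs)]
  · refine hinf.congr' ?_
    filter_upwards [Ioi_mem_atTop 0] with s hs
    rw [Function.update_of_ne (ne_of_gt hs)]

/-- Integration by parts in one coordinate. -/
theorem integral_orthant_deriv_eq_zero {n : ℕ} (k : Fin n) {f f' : (Fin n → ℝ) → ℝ}
    (hf : Integrable f (orthant n)) (hf' : Integrable f' (orthant n))
    (hd : ∀ x, (∀ i, 0 < x i) → HasDerivAt (fun t => f (Function.update x k t)) (f' x) (x k))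
    (h0 : ∀ x, (∀ i, 0 < x i) → Tendsto (fun t => f (Function.update x k t)) (𝓝[>] 0) (𝓝 0)) :
    ∫ x, f' x ∂orthant n = 0 := by
  obtain ⟨m, rfl⟩ : ∃ m, n = m + 1 := ⟨n - 1, by have := k.2; omega⟩
  have mp := (measurePreserving_piFinSuccAbove
    (fun _ : Fin (m + 1) => (volume : Measure ℝ).restrict (Set.Ioi 0)) k).symm
  change MeasurePreserving _ (((volume : Measure ℝ).restrict (Set.Ioi 0)).prod (orthant m))
    (orthant (m + 1)) at mp
  have emb := (MeasurableEquiv.piFinSuccAbove (fun _ : Fin (m + 1) => ℝ) k).symm.measurableEmbedding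
  rw [← mp.integrable_comp_emb emb] at hf hf'
  rw [← mp.integral_comp emb]
  have e : ∀ p : ℝ × (Fin m → ℝ),
      (MeasurableEquiv.piFinSuccAbove (fun _ : Fin (m + 1) => ℝ) k).symm p
        = (k.insertNth p.1 p.2 : Fin (m + 1) → ℝ) := fun p => rfl
  simp only [e, Function.comp_def] at hf hf' ⊢
  rw [integral_prod_symm _ hf']
  refine integral_eq_zero_of_ae ?_
  filter_upwards [hf.prod_left_ae, hf'.prod_left_ae, ae_orthant_pos m] with y hy hy' hpos
  have hins : ∀ t, 0 < t → ∀ i, 0 < (k.insertNth t y : Fin (m + 1) → ℝ) i := by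
    intro t ht i
    refine Fin.succAboveCases k ?_ (fun j => ?_) i
    · simpa using ht
    · simpa using hpos j
  refine integral_deriv_Ioi_eq_zero (g := fun t => f (k.insertNth t y)) (fun t ht => ?_) hy hy' ?_
  · have := hd _ (hins t ht)
    simpa using this
  · have := h0 _ (hins 1 one_pos)
    simpa using this

/-! ### The Laguerre weight -/

/-- The weight `∏ x_i ^ (a - 1) exp (-b x_i)`. -/
def laguerreWeight {n : ℕ} (a b : ℝ) (x : Fin n → ℝ) : ℝ :=
  ∏ i, (x i ^ (a - 1) * Real.exp (-(b * x i)))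

/-- The regularized interaction `∏_{i ≠ j} ((x_i - x_j)² + ε) ^ (γ / 2)`. -/
def repulsion {n : ℕ} (γ ε : ℝ) (x : Fin n → ℝ) : ℝ :=
  ∏ i, ∏ j ∈ Finset.univ.erase i, ((x i - x j) ^ 2 + ε) ^ (γ / 2)

section

variable {n : ℕ} {x : Fin n → ℝ} {γ ε a b : ℝ}

@[fun_prop]
theorem measurable_laguerreWeight (a b : ℝ) :
    Measurable (laguerreWeight a b : (Fin n → ℝ) → ℝ) := by
  unfold laguerreWeight
  fun_prop

@[fun_prop]
theorem measurable_repulsion (γ ε : ℝ) : Measurable (repulsion γ ε : (Fin n → ℝ) → ℝ) := by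
  unfold repulsion
  fun_prop

theorem laguerreWeight_pos (hx : ∀ i, 0 < x i) (a b : ℝ) : 0 < laguerreWeight a b x :=
  Finset.prod_pos fun i _ => mul_pos (Real.rpow_pos_of_pos (hx i) _) (Real.exp_pos _)

theorem repulsion_nonneg (hε : 0 ≤ ε) : 0 ≤ repulsion γ ε x :=
  Finset.prod_nonneg fun _ _ => Finset.prod_nonneg fun _ _ => Real.rpow_nonneg (by positivity) _

theorem repulsion_zero_pos (hx : ∀ i j, i ≠ j → x i ≠ x j) : 0 < repulsion γ 0 x := by
  refine Finset.prod_pos fun i _ => Finset.prod_pos fun j hj => Real.rpow_pos_of_pos ?_ _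
  have := sub_ne_zero.2 (hx i j (Finset.ne_of_mem_erase hj).symm)
  positivity

theorem laguerreWeight_perm (σ : Equiv.Perm (Fin n)) :
    laguerreWeight a b (fun i => x (σ i)) = laguerreWeight a b x :=
  Equiv.prod_comp σ fun i => x i ^ (a - 1) * Real.exp (-(b * x i))

theorem repulsion_perm (σ : Equiv.Perm (Fin n)) :
    repulsion γ ε (fun i => x (σ i)) = repulsion γ ε x := by
  have h : ∀ y : Fin n → ℝ, repulsion γ ε y
      = ∏ i, ∏ j, if i = j then 1 else ((y i - y j) ^ 2 + ε) ^ (γ / 2) := by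
    intro y
    refine Finset.prod_congr rfl fun i _ => ?_
    rw [← Finset.mul_prod_erase _ _ (Finset.mem_univ i), if_pos rfl, one_mul]
    refine Finset.prod_congr rfl fun j hj => ?_
    rw [if_neg (Finset.ne_of_mem_erase hj).symm]
  rw [h, h]
  refine Eq.trans ?_ (Equiv.prod_comp σ fun i =>
    ∏ j, if i = j then 1 else ((x i - x j) ^ 2 + ε) ^ (γ / 2))
  refine Finset.prod_congr rfl fun i _ => ?_
  refine Eq.trans ?_ (Equiv.prod_comp σ fun j =>
    if σ i = j then 1 else ((x (σ i) - x j) ^ 2 + ε) ^ (γ / 2))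
  simp only [EmbeddingLike.apply_eq_iff_eq]

theorem le_one_add_sum (hx : ∀ i, 0 < x i) (i : Fin n) : x i ≤ 1 + ∑ j, x j := by
  have := Finset.single_le_sum (f := x) (fun j _ => (hx j).le) (Finset.mem_univ i)
  linarith

theorem one_le_one_add_sum (hx : ∀ i, 0 < x i) : 1 ≤ 1 + ∑ j, x j := by
  have : 0 ≤ ∑ j, x j := Finset.sum_nonneg fun j _ => (hx j).le
  linarith

/-- The bound is crude but uniform in `ε ≤ 1`, as domination for `ε → 0` requires. For two distinct
indices `x_i + x_j ≤ Q - 1`, hence `(x_i - x_j)² + ε ≤ Q²`. -/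
theorem repulsion_le (hγ : 0 ≤ γ) (hx : ∀ i, 0 < x i) (hε : 0 ≤ ε) (hε1 : ε ≤ 1) :
    repulsion γ ε x ≤ (1 + ∑ j, x j) ^ (γ * (n * n)) := by
  have hQ := one_le_one_add_sum hx
  set Q := 1 + ∑ j, x j with hQdef
  have hfac : ∀ i j, i ≠ j → ((x i - x j) ^ 2 + ε) ^ (γ / 2) ≤ Q ^ γ := by
    intro i j hij
    have h2 : (x i - x j) ^ 2 + ε ≤ Q ^ (2 : ℝ) := by
      have hi := hx i
      have hj := hx j
      have hs : x i + x j ≤ ∑ j, x j := by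
        rw [← Finset.sum_pair hij]
        exact Finset.sum_le_sum_of_subset_of_nonneg (Finset.subset_univ _) fun j _ _ => (hx j).le
      rw [Real.rpow_two]
      nlinarith [mul_pos hi hj]
    calc _ ≤ (Q ^ (2 : ℝ)) ^ (γ / 2) :=
          Real.rpow_le_rpow (by positivity) h2 (by positivity)
      _ = Q ^ γ := by rw [← Real.rpow_mul (by linarith)]; congr 1; ring
  have hQγ : 1 ≤ Q ^ γ := Real.one_le_rpow hQ hγ
  calc repulsion γ ε x ≤ ∏ i : Fin n, (Q ^ γ) ^ n := by
        refine Finset.prod_le_prod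
          (fun i _ => Finset.prod_nonneg fun j _ => Real.rpow_nonneg (by positivity) _) fun i _ => ?_
        calc _ ≤ ∏ j ∈ Finset.univ.erase i, Q ^ γ :=
              Finset.prod_le_prod (fun j _ => Real.rpow_nonneg (by positivity) _)
                fun j hj => hfac i j (Finset.ne_of_mem_erase hj).symm
          _ ≤ (Q ^ γ) ^ n := by
              rw [Finset.prod_const]
              refine pow_le_pow_right₀ hQγ ?_
              exact (Finset.card_le_univ _).trans (by simp)
    _ = Q ^ (γ * (n * n)) := by
        rw [Finset.prod_const, ← pow_mul, ← Real.rpow_natCast, ← Real.rpow_mul (by linarith)]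
        simp

theorem integrable_laguerreWeight (ha : 0 < a) (hb : 0 < b) :
    Integrable (laguerreWeight a b) (orthant n) := by
  unfold laguerreWeight orthant
  refine Integrable.fintype_prod (f := fun _ t => t ^ (a - 1) * Real.exp (-(b * t))) fun _ => ?_
  have := integrableOn_rpow_mul_exp_neg_mul_rpow (p := 1) (s := a - 1) (b := b) (by linarith)
    one_pos hb
  simpa [IntegrableOn] using this

/-- Functions of polynomial growth are integrable against the Laguerre weight. -/
theorem exists_le_laguerreWeight (hb : 0 < b) (C : ℝ) {m : ℝ} (hm : 0 ≤ m) :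
    ∃ C', ∀ x : Fin n → ℝ, (∀ i, 0 < x i) →
      C * (1 + ∑ j, x j) ^ m * laguerreWeight a b x ≤ C' * laguerreWeight a (b / 2) x := by
  -- With `η ≤ 1` one has `1 + s ≤ exp (η s) / η`, and `η m ≤ b / 2` lets half of the exponential
  -- decay absorb the power; `m + 1` avoids dividing by zero.
  set η : ℝ := min 1 (b / (2 * (m + 1))) with hη
  have hη0 : 0 < η := lt_min one_pos (by positivity)
  have hη1 : η ≤ 1 := min_le_left _ _
  have hηm : η * m ≤ b / 2 := by
    have h1 : η ≤ b / (2 * (m + 1)) := min_le_right _ _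
    have h2 := mul_le_mul_of_nonneg_right h1 hm
    refine h2.trans ?_
    rw [div_mul_eq_mul_div, div_le_div_iff₀ (by positivity) (by positivity)]
    nlinarith
  refine ⟨|C| * (1 / η) ^ m, fun x hx => ?_⟩
  set s := ∑ j, x j with hs
  have hs0 : 0 ≤ s := Finset.sum_nonneg fun j _ => (hx j).le
  have h1 : 1 + s ≤ (1 / η) * Real.exp (η * s) := by
    have := Real.add_one_le_exp (η * s)
    rw [one_div, inv_mul_eq_div, le_div_iff₀ hη0]
    nlinarith
  have h2 : (1 + s) ^ m ≤ (1 / η) ^ m * Real.exp (b / 2 * s) := by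
    calc (1 + s) ^ m ≤ ((1 / η) * Real.exp (η * s)) ^ m :=
          Real.rpow_le_rpow (by linarith) h1 hm
      _ = (1 / η) ^ m * Real.exp (η * s * m) := by
          rw [Real.mul_rpow (by positivity) (Real.exp_pos _).le, ← Real.exp_mul]
      _ ≤ _ := by
          refine mul_le_mul_of_nonneg_left (Real.exp_le_exp.2 ?_) (by positivity)
          have := mul_le_mul_of_nonneg_right hηm hs0
          linarith
  have h3 : laguerreWeight a (b / 2) x = Real.exp (b / 2 * s) * laguerreWeight a b x := by
    rw [laguerreWeight, laguerreWeight, hs, Finset.mul_sum, Real.exp_sum,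
      ← Finset.prod_mul_distrib]
    refine Finset.prod_congr rfl fun i _ => ?_
    rw [mul_left_comm, ← Real.exp_add]
    congr 2
    ring
  have hw := laguerreWeight_pos hx a b
  rw [h3]
  calc C * (1 + s) ^ m * laguerreWeight a b x
      ≤ |C| * ((1 / η) ^ m * Real.exp (b / 2 * s)) * laguerreWeight a b x := by
        gcongr
        exact le_abs_self C
    _ = _ := by ring

theorem integrable_of_growth (ha : 0 < a) (hb : 0 < b) {F : (Fin n → ℝ) → ℝ} (hF : Measurable F)
    (C : ℝ) {m : ℝ} (hm : 0 ≤ m)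
    (h : ∀ x : Fin n → ℝ, (∀ i, 0 < x i) →
      |F x| ≤ C * (1 + ∑ j, x j) ^ m * laguerreWeight a b x) :
    Integrable F (orthant n) := by
  obtain ⟨C', hC'⟩ := exists_le_laguerreWeight (n := n) (a := a) hb C hm
  refine ((integrable_laguerreWeight ha (half_pos hb)).const_mul C').mono'
    hF.aestronglyMeasurable ?_
  filter_upwards [ae_orthant_pos n] with x hx
  exact (h x hx).trans (hC' x hx)

end

/-! ### Aomoto's recursion -/

/-- The integral of `p` against the Laguerre weight with regularized interaction. -/
def laguerreIntegral {n : ℕ} (γ ε a b : ℝ) (p : (Fin n → ℝ) → ℝ) : ℝ :=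
  ∫ x, p x * (laguerreWeight a b x * repulsion γ ε x) ∂orthant n

section

variable {n : ℕ} {γ ε a b : ℝ}

theorem abs_mul_weight_le (hγ : 0 ≤ γ) (hε : 0 ≤ ε) (hε1 : ε ≤ 1)
    {C m r : ℝ} {x : Fin n → ℝ} (hx : ∀ i, 0 < x i) (h : |r| ≤ C * (1 + ∑ j, x j) ^ m) :
    |r * (laguerreWeight a b x * repulsion γ ε x)|
      ≤ C * (1 + ∑ j, x j) ^ (m + γ * (n * n)) * laguerreWeight a b x := by
  have hw := laguerreWeight_pos hx a b
  have hD := repulsion_nonneg (γ := γ) (x := x) hε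
  have hQ := one_le_one_add_sum hx
  rw [abs_mul, abs_of_nonneg (mul_nonneg hw.le hD), Real.rpow_add (by linarith)]
  have h2 := repulsion_le hγ hx hε hε1
  have h3 : 0 ≤ C * (1 + ∑ j, x j) ^ m := (abs_nonneg _).trans h
  calc _ ≤ (C * (1 + ∑ j, x j) ^ m) *
        (laguerreWeight a b x * (1 + ∑ j, x j) ^ (γ * (n * n))) := by gcongr
    _ = _ := by ring

theorem integrable_mul_weight (hγ : 0 ≤ γ) (hε : 0 ≤ ε) (hε1 : ε ≤ 1) (ha : 0 < a) (hb : 0 < b)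
    {p : (Fin n → ℝ) → ℝ} (hp : Measurable p) (C : ℝ) {m : ℝ} (hm : 0 ≤ m)
    (h : ∀ x : Fin n → ℝ, (∀ i, 0 < x i) → |p x| ≤ C * (1 + ∑ j, x j) ^ m) :
    Integrable (fun x => p x * (laguerreWeight a b x * repulsion γ ε x)) (orthant n) :=
  integrable_of_growth ha hb (by fun_prop) C (m := m + γ * (n * n)) (by positivity)
    fun x hx => abs_mul_weight_le hγ hε hε1 hx (h x hx)

theorem tendsto_repulsion (hγ : 0 ≤ γ) (x : Fin n → ℝ) :
    Tendsto (fun N : ℕ => repulsion γ (1 / ((N : ℝ) + 1)) x) atTop (𝓝 (repulsion γ 0 x)) := by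
  unfold repulsion
  refine tendsto_finsetProd _ fun i _ => tendsto_finsetProd _ fun j _ => ?_
  exact ((tendsto_const_nhds.add tendsto_one_div_add_atTop_nhds_zero_nat)).rpow_const
    (Or.inr (by positivity))

theorem tendsto_laguerreIntegral (hγ : 0 ≤ γ) (ha : 0 < a) (hb : 0 < b)
    {p : ℕ → (Fin n → ℝ) → ℝ} {q : (Fin n → ℝ) → ℝ} (hp : ∀ N, Measurable (p N)) (C : ℝ) {m : ℝ}
    (hm : 0 ≤ m)
    (h : ∀ N, ∀ x : Fin n → ℝ, (∀ i, 0 < x i) → |p N x| ≤ C * (1 + ∑ j, x j) ^ m)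
    (hlim : ∀ᵐ x ∂orthant n, Tendsto (fun N => p N x) atTop (𝓝 (q x))) :
    Tendsto (fun N : ℕ => laguerreIntegral γ (1 / ((N : ℝ) + 1)) a b (p N)) atTop
      (𝓝 (laguerreIntegral γ 0 a b q)) := by
  obtain ⟨C', hC'⟩ := exists_le_laguerreWeight (n := n) (a := a) hb C
    (m := m + γ * (n * n)) (by positivity)
  refine tendsto_integral_of_dominated_convergence
    (fun x => C' * laguerreWeight a (b / 2) x) (fun N => ?_)
    ((integrable_laguerreWeight ha (half_pos hb)).const_mul C') (fun N => ?_) ?_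
  · have := hp N
    exact Measurable.aestronglyMeasurable (by fun_prop)
  · filter_upwards [ae_orthant_pos n] with x hx
    refine (abs_mul_weight_le hγ (by positivity) ?_ hx (h N x hx)).trans (hC' x hx)
    rw [div_le_one (by positivity)]
    linarith [(N.cast_nonneg : (0 : ℝ) ≤ N)]
  · filter_upwards [hlim] with x hx
    exact hx.mul (tendsto_const_nhds.mul (tendsto_repulsion hγ x))

theorem laguerreIntegral_perm (σ : Equiv.Perm (Fin n)) {p : (Fin n → ℝ) → ℝ} (hp : Measurable p) :
    laguerreIntegral γ ε a b (fun x => p fun i => x (σ i)) = laguerreIntegral γ ε a b p := by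
  unfold laguerreIntegral
  rw [← integral_orthant_perm σ (f := fun x => p x * (laguerreWeight a b x * repulsion γ ε x))
    (by fun_prop)]
  simp only [laguerreWeight_perm, repulsion_perm]

theorem continuous_repulsion (hε : 0 < ε) : Continuous (repulsion γ ε : (Fin n → ℝ) → ℝ) := by
  unfold repulsion
  refine continuous_finsetProd _ fun i _ => continuous_finsetProd _ fun j _ => ?_
  refine Continuous.rpow_const (by fun_prop) fun x => Or.inl ?_
  positivity

/-- With `ε > 0` the interaction is differentiable also where coordinates coincide, which may fail
at `ε = 0` for small `γ`. The factor `2 γ` collects the ordered pairs `(k, j)` and `(j, k)`. -/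
theorem hasDerivAt_repulsion (hε : 0 < ε) (x : Fin n → ℝ) (k : Fin n) :
    HasDerivAt (fun t => repulsion γ ε (Function.update x k t))
      (repulsion γ ε x *
        (2 * γ * ∑ j ∈ Finset.univ.erase k, (x k - x j) / ((x k - x j) ^ 2 + ε))) (x k) := by
  -- The sum runs over all pairs for symmetry; each diagonal term is the constant `γ / 2 * ln ε` and
  -- is subtracted again.
  have hexp : ∀ y : Fin n → ℝ, repulsion γ ε y
      = Real.exp (∑ i, ∑ j, γ / 2 * (Real.log ((y i - y j) ^ 2 + ε))
          - ∑ i : Fin n, γ / 2 * Real.log ε) := by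
    intro y
    rw [← Finset.sum_sub_distrib, Real.exp_sum]
    refine Finset.prod_congr rfl fun i _ => ?_
    rw [← Finset.add_sum_erase _ _ (Finset.mem_univ i), sub_self]
    rw [zero_pow two_ne_zero, zero_add, add_sub_cancel_left, Real.exp_sum]
    refine Finset.prod_congr rfl fun j _ => ?_
    rw [Real.rpow_def_of_pos (by positivity), mul_comm]
  have hcoord : ∀ i, HasDerivAt (fun t => Function.update x k t i) (if i = k then 1 else 0)
      (x k) := by
    intro i
    by_cases hik : i = k
    · subst hik
      simpa using hasDerivAt_id' (x i)
    · simpa [hik] using hasDerivAt_const (x k) (x i)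
  have hterm : ∀ i j, HasDerivAt
      (fun t => γ / 2 * Real.log ((Function.update x k t i - Function.update x k t j) ^ 2 + ε))
      ((if i = k then γ * ((x k - x j) / ((x k - x j) ^ 2 + ε)) else 0) +
        (if j = k then γ * ((x k - x i) / ((x k - x i) ^ 2 + ε)) else 0)) (x k) := by
    intro i j
    have h1 := ((((hcoord i).sub (hcoord j)).pow 2).add_const ε).log
      (by simp only [Pi.sub_apply, Pi.pow_apply]; positivity) |>.const_mul (γ / 2)
    refine h1.congr_deriv ?_
    simp only [Pi.sub_apply, Pi.pow_apply, Function.update_eq_self]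
    by_cases hi : i = k <;> by_cases hj : j = k
    · subst hi; subst hj; simp
    · subst hi; simp [hj]; ring
    · subst hj
      have e : (x j - x i) ^ 2 + ε = (x i - x j) ^ 2 + ε := by ring
      simp [hi, e]; ring
    · simp [hi, hj]
  have hsum := ((HasDerivAt.fun_sum fun i (_ : i ∈ Finset.univ) =>
    HasDerivAt.fun_sum fun j (_ : j ∈ Finset.univ) => hterm i j).sub_const
      (∑ i : Fin n, γ / 2 * Real.log ε)).exp
  simp only [← hexp, Function.update_eq_self] at hsum
  refine hsum.congr_deriv ?_
  congr 1
  simp only [Finset.sum_add_distrib, Finset.sum_ite_irrel, Finset.sum_const_zero,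
    Finset.sum_ite_eq', Finset.mem_univ, if_true]
  rw [← Finset.mul_sum, ← Finset.add_sum_erase _ _ (Finset.mem_univ k)]
  simp only [sub_self, zero_div, zero_add]
  ring

theorem abs_prod_le {S : Finset (Fin n)} {x : Fin n → ℝ} (hx : ∀ i, 0 < x i) :
    |∏ i ∈ S, x i| ≤ (1 + ∑ j, x j) ^ (n : ℝ) := by
  have hQ := one_le_one_add_sum hx
  rw [abs_of_nonneg (Finset.prod_nonneg fun i _ => (hx i).le), Real.rpow_natCast]
  calc ∏ i ∈ S, x i ≤ ∏ i ∈ S, (1 + ∑ j, x j) :=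
        Finset.prod_le_prod (fun i _ => (hx i).le) fun i _ => le_one_add_sum hx i
    _ ≤ _ := by
        rw [Finset.prod_const]
        exact pow_le_pow_right₀ hQ ((Finset.card_le_univ S).trans (by simp))

theorem abs_mul_le_of_le {x : Fin n → ℝ} (hx : ∀ i, 0 < x i) {r s C m m' : ℝ}
    (hr : |r| ≤ (1 + ∑ j, x j) ^ m) (hs : |s| ≤ C * (1 + ∑ j, x j) ^ m') :
    |r * s| ≤ C * (1 + ∑ j, x j) ^ (m + m') := by
  have hQ := one_le_one_add_sum hx
  rw [abs_mul, Real.rpow_add (by linarith)]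
  calc |r| * |s| ≤ (1 + ∑ j, x j) ^ m * (C * (1 + ∑ j, x j) ^ m') := by gcongr
    _ = _ := by ring

theorem abs_quotient_le (hε : 0 < ε) {x : Fin n → ℝ} (hx : ∀ i, 0 < x i) (i j : Fin n) :
    |x i * ((x i - x j) / ((x i - x j) ^ 2 + ε))| ≤ 1 / ε * (1 + ∑ j, x j) ^ (2 : ℝ) := by
  have hi := le_one_add_sum hx i
  have hj := le_one_add_sum hx j
  have hi0 := hx i
  have hj0 := hx j
  have h1 : |x i - x j| ≤ 1 + ∑ j, x j := by rw [abs_le]; constructor <;> linarith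
  have hQ0 : 0 ≤ 1 + ∑ j, x j := hi0.le.trans hi
  have hden : 0 < (x i - x j) ^ 2 + ε := by positivity
  rw [abs_mul, abs_div, abs_of_pos hi0, abs_of_pos hden, ← mul_div_assoc, div_le_iff₀ hden,
    Real.rpow_two]
  calc x i * |x i - x j| ≤ (1 + ∑ j, x j) * (1 + ∑ j, x j) := by gcongr
    _ = 1 / ε * (1 + ∑ j, x j) ^ 2 * ε := by field_simp
    _ ≤ _ := by
        refine mul_le_mul_of_nonneg_left ?_ (by positivity)
        linarith [sq_nonneg (x i - x j)]

/-- The regularized form of Aomoto's identity, by integration by parts. -/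
theorem aomoto_regularized (hγ : 0 ≤ γ) (hε : 0 < ε) (hε1 : ε ≤ 1) (ha : 0 < a)
    {S : Finset (Fin n)} {k : Fin n} (hk : k ∉ S) :
    a * laguerreIntegral γ ε a 1 (fun x => ∏ i ∈ S, x i)
      - laguerreIntegral γ ε a 1 (fun x => ∏ i ∈ insert k S, x i)
      + 2 * γ * ∑ j ∈ Finset.univ.erase k, laguerreIntegral γ ε a 1
          (fun x => (∏ i ∈ S, x i) * (x k * ((x k - x j) / ((x k - x j) ^ 2 + ε)))) = 0 := by
  have i1 : Integrable (fun x : Fin n → ℝ => (∏ i ∈ S, x i) *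
      (laguerreWeight a 1 x * repulsion γ ε x)) (orthant n) :=
    integrable_mul_weight hγ hε.le hε1 ha one_pos (by fun_prop) 1 (m := n) (by positivity)
      fun x hx => by rw [one_mul]; exact abs_prod_le hx
  have i2 : Integrable (fun x : Fin n → ℝ => (∏ i ∈ insert k S, x i) *
      (laguerreWeight a 1 x * repulsion γ ε x)) (orthant n) :=
    integrable_mul_weight hγ hε.le hε1 ha one_pos (by fun_prop) 1 (m := n) (by positivity)
      fun x hx => by rw [one_mul]; exact abs_prod_le hx
  have i3 : ∀ j, Integrable (fun x : Fin n → ℝ =>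
      ((∏ i ∈ S, x i) * (x k * ((x k - x j) / ((x k - x j) ^ 2 + ε)))) *
      (laguerreWeight a 1 x * repulsion γ ε x)) (orthant n) := fun j =>
    integrable_mul_weight hγ hε.le hε1 ha one_pos (by fun_prop) (1 / ε) (m := n + 2)
      (by positivity) fun x hx => abs_mul_le_of_le hx (abs_prod_le hx) (abs_quotient_le hε hx k j)
  have i4 : Integrable (fun x : Fin n → ℝ => ∑ j ∈ Finset.univ.erase k,
      ((∏ i ∈ S, x i) * (x k * ((x k - x j) / ((x k - x j) ^ 2 + ε)))) *
      (laguerreWeight a 1 x * repulsion γ ε x)) (orthant n) := integrable_finsetSum _ fun j _ => i3 j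
  have i5 : Integrable (fun x : Fin n → ℝ =>
      a * ((∏ i ∈ S, x i) * (laguerreWeight a 1 x * repulsion γ ε x)) -
      (∏ i ∈ insert k S, x i) * (laguerreWeight a 1 x * repulsion γ ε x)) (orthant n) :=
    (i1.const_mul a).sub i2
  unfold laguerreIntegral
  rw [← integral_finsetSum _ fun j _ => i3 j, ← integral_const_mul, ← integral_const_mul,
    ← integral_sub (i1.const_mul a) i2, ← integral_add i5 (i4.const_mul (2 * γ))]
  -- The integrated derivative is that of `x_k ∏_S x_i` times the density. The extra factor `x_k`
  -- makes the boundary term `x_k ^ a` vanish at `0`, since `a > 0`.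
  refine integral_orthant_deriv_eq_zero k i2
    (i5.add (i4.const_mul (2 * γ))) ?_ ?_
  all_goals
    intro x hx
    have hfun : (fun t => (∏ i ∈ insert k S, Function.update x k t i) *
        (laguerreWeight a 1 (Function.update x k t) * repulsion γ ε (Function.update x k t)))
        = fun t => ((∏ i ∈ S, x i) * ∏ i ∈ Finset.univ.erase k,
            (x i ^ (a - 1) * Real.exp (-(1 * x i)))) *
          ((t * (t ^ (a - 1) * Real.exp (-t))) * repulsion γ ε (Function.update x k t)) := by
      ext t
      rw [Finset.prod_insert hk, laguerreWeight, ← Finset.mul_prod_erase _ _ (Finset.mem_univ k)]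
      have e1 : ∏ i ∈ S, Function.update x k t i = ∏ i ∈ S, x i :=
        Finset.prod_congr rfl fun i hi =>
          Function.update_of_ne (fun h : i = k => hk (h ▸ hi)) _ _
      have e2 : ∏ i ∈ Finset.univ.erase k, (Function.update x k t i ^ (a - 1) *
          Real.exp (-(1 * Function.update x k t i))) =
          ∏ i ∈ Finset.univ.erase k, (x i ^ (a - 1) * Real.exp (-(1 * x i))) :=
        Finset.prod_congr rfl fun i hi => by
          rw [Function.update_of_ne (Finset.ne_of_mem_erase hi)]
      rw [e1, e2, Function.update_self, one_mul]
      ring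
    rw [hfun]
  · have hxk := hx k
    have h1 : HasDerivAt (fun t : ℝ => t * (t ^ (a - 1) * Real.exp (-t)))
        ((a - x k) * (x k ^ (a - 1) * Real.exp (-(x k)))) (x k) := by
      have := (hasDerivAt_id (x k)).mul
        ((Real.hasDerivAt_rpow_const (p := a - 1) (Or.inl hxk.ne')).mul (hasDerivAt_neg (x k)).exp)
      refine this.congr_deriv ?_
      have e : x k ^ (a - 1) = x k ^ (a - 1 - 1) * x k := by
        rw [← Real.rpow_add_one hxk.ne']; congr 1; ring
      simp only [Pi.mul_apply, id]
      rw [e]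
      ring
    refine ((h1.mul (hasDerivAt_repulsion (γ := γ) hε x k)).const_mul _).congr_deriv ?_
    rw [Function.update_eq_self, Finset.prod_insert hk, laguerreWeight,
      ← Finset.mul_prod_erase _ _ (Finset.mem_univ k), ← Finset.sum_mul, ← Finset.mul_sum,
      ← Finset.mul_sum]
    simp only [one_mul]
    generalize ∑ j ∈ Finset.univ.erase k, (x k - x j) / ((x k - x j) ^ 2 + ε) = s
    ring
  · have h1 : Tendsto (fun t : ℝ => t * (t ^ (a - 1) * Real.exp (-t))) (𝓝[>] 0) (𝓝 0) := by
      have h2 : Tendsto (fun t : ℝ => t ^ a * Real.exp (-t)) (𝓝 0) (𝓝 (0 ^ a * Real.exp (-0))) :=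
        (Real.continuousAt_rpow_const 0 a (Or.inr ha.le)).tendsto.mul
          ((Real.continuous_exp.comp continuous_neg).tendsto 0)
      rw [Real.zero_rpow ha.ne', zero_mul] at h2
      refine (h2.mono_left nhdsWithin_le_nhds).congr' ?_
      filter_upwards [self_mem_nhdsWithin] with t ht
      have ht : 0 < t := ht
      rw [← mul_assoc, mul_comm t, ← Real.rpow_add_one ht.ne', sub_add_cancel]
    have h3 : Tendsto (fun t => repulsion γ ε (Function.update x k t)) (𝓝[>] 0)
        (𝓝 (repulsion γ ε (Function.update x k 0))) :=
      (((continuous_repulsion hε).comp (by fun_prop :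
        Continuous fun t : ℝ => Function.update x k t)).tendsto 0).mono_left nhdsWithin_le_nhds
    simpa using (h1.mul h3).const_mul _

/-- When `j ∈ S`, the product `x_k ∏_S x_i` contains both `x_j` and `x_k`, so it is symmetric under
their exchange while the quotient is odd: the integral equals its own negative. -/
theorem aomoto_term_of_mem {S : Finset (Fin n)} {k j : Fin n} (hj : j ∈ S) (hk : k ∉ S) :
    laguerreIntegral γ ε a b
      (fun x => (∏ i ∈ S, x i) * (x k * ((x k - x j) / ((x k - x j) ^ 2 + ε)))) = 0 := by
  set p : (Fin n → ℝ) → ℝ :=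
    fun x => (∏ i ∈ S, x i) * (x k * ((x k - x j) / ((x k - x j) ^ 2 + ε))) with hp
  have h := laguerreIntegral_perm (γ := γ) (ε := ε) (a := a) (b := b) (Equiv.swap k j)
    (p := p) (by fun_prop)
  have e : (fun x : Fin n → ℝ => p fun i => x (Equiv.swap k j i)) = fun x => -p x := by
    ext x
    have e1 : (∏ i ∈ S, x (Equiv.swap k j i)) * x j = (∏ i ∈ S, x i) * x k := by
      have hne : ∀ i ∈ S.erase j, Equiv.swap k j i = i := fun i hi =>
        Equiv.swap_apply_of_ne_of_ne (fun h => hk (h ▸ Finset.mem_of_mem_erase hi))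
          (Finset.ne_of_mem_erase hi)
      rw [← Finset.mul_prod_erase S _ hj, ← Finset.mul_prod_erase S x hj,
        Finset.prod_congr rfl fun i hi => by rw [hne i hi], Equiv.swap_apply_right]
      ring
    have e2 : (x j - x k) ^ 2 + ε = (x k - x j) ^ 2 + ε := by ring
    simp only [hp, Equiv.swap_apply_left, Equiv.swap_apply_right, e2]
    rw [← mul_assoc, e1]
    ring
  rw [e] at h
  have h2 : laguerreIntegral γ ε a b (fun x => -p x) = -laguerreIntegral γ ε a b p := by
    simp only [laguerreIntegral, neg_mul, integral_neg]
  rw [h2] at h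
  linarith

/-- When `j ∉ S`, averaging over the exchange of `j` and `k` uses `x_k (x_k - x_j) + x_j (x_j - x_k)
= (x_k - x_j)²`. This removes the singularity, leaving a quotient bounded by one. -/
theorem aomoto_term_of_notMem (hγ : 0 ≤ γ) (hε : 0 < ε) (hε1 : ε ≤ 1) (ha : 0 < a) (hb : 0 < b)
    {S : Finset (Fin n)} {k j : Fin n} (hj : j ∉ S) (hk : k ∉ S) :
    2 * laguerreIntegral γ ε a b
      (fun x => (∏ i ∈ S, x i) * (x k * ((x k - x j) / ((x k - x j) ^ 2 + ε))))
    = laguerreIntegral γ ε a b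
      (fun x => (∏ i ∈ S, x i) * ((x k - x j) ^ 2 / ((x k - x j) ^ 2 + ε))) := by
  set p : (Fin n → ℝ) → ℝ :=
    fun x => (∏ i ∈ S, x i) * (x k * ((x k - x j) / ((x k - x j) ^ 2 + ε))) with hp
  have h := laguerreIntegral_perm (γ := γ) (ε := ε) (a := a) (b := b) (Equiv.swap k j)
    (p := p) (by fun_prop)
  have e : (fun x : Fin n → ℝ => p fun i => x (Equiv.swap k j i)) =
      fun x => (∏ i ∈ S, x i) * (x j * ((x j - x k) / ((x j - x k) ^ 2 + ε))) := by
    ext x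
    have e1 : (∏ i ∈ S, x (Equiv.swap k j i)) = ∏ i ∈ S, x i :=
      Finset.prod_congr rfl fun i hi => by
        rw [Equiv.swap_apply_of_ne_of_ne (fun h : i = k => hk (h ▸ hi))
          (fun h : i = j => hj (h ▸ hi))]
    simp only [hp, Equiv.swap_apply_left, Equiv.swap_apply_right, e1]
  rw [e] at h
  have int : ∀ k j : Fin n, Integrable (fun x : Fin n → ℝ =>
      ((∏ i ∈ S, x i) * (x k * ((x k - x j) / ((x k - x j) ^ 2 + ε)))) *
      (laguerreWeight a b x * repulsion γ ε x)) (orthant n) := fun k j =>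
    integrable_mul_weight hγ hε.le hε1 ha hb (by fun_prop) (1 / ε) (m := n + 2)
      (by positivity) fun x hx => abs_mul_le_of_le hx (abs_prod_le hx) (abs_quotient_le hε hx k j)
  rw [two_mul]
  nth_rw 2 [← h]
  unfold laguerreIntegral
  rw [← integral_add (int k j) (int j k)]
  congr 1
  ext x
  have e2 : (x j - x k) ^ 2 + ε = (x k - x j) ^ 2 + ε := by ring
  simp only [e2]
  ring

/-- **Aomoto's recursion** for the Laguerre ensemble. -/
theorem aomoto (hγ : 0 ≤ γ) (ha : 0 < a) {S : Finset (Fin n)} {k : Fin n} (hk : k ∉ S) :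
    laguerreIntegral γ 0 a 1 (fun x => ∏ i ∈ insert k S, x i)
      = (a + γ * ((n : ℝ) - 1 - S.card)) * laguerreIntegral γ 0 a 1 (fun x => ∏ i ∈ S, x i) := by
  have hε : ∀ N : ℕ, 0 < 1 / ((N : ℝ) + 1) ∧ 1 / ((N : ℝ) + 1) ≤ 1 := fun N => by
    refine ⟨by positivity, ?_⟩
    rw [div_le_one (by positivity)]
    linarith [(N.cast_nonneg : (0 : ℝ) ≤ N)]
  have hreg : ∀ N : ℕ,
      a * laguerreIntegral γ (1 / ((N : ℝ) + 1)) a 1 (fun x => ∏ i ∈ S, x i)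
      - laguerreIntegral γ (1 / ((N : ℝ) + 1)) a 1 (fun x => ∏ i ∈ insert k S, x i)
      + γ * ∑ j ∈ (Finset.univ.erase k) \ S, laguerreIntegral γ (1 / ((N : ℝ) + 1)) a 1
          (fun x => (∏ i ∈ S, x i) *
            ((x k - x j) ^ 2 / ((x k - x j) ^ 2 + 1 / ((N : ℝ) + 1)))) = 0 := by
    intro N
    obtain ⟨h0, h1⟩ := hε N
    have hsub : S ⊆ Finset.univ.erase k := fun i hi =>
      Finset.mem_erase.2 ⟨fun h => hk (h ▸ hi), Finset.mem_univ i⟩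
    have hz : ∀ j ∈ S, 2 * laguerreIntegral γ (1 / ((N : ℝ) + 1)) a 1 (fun x => (∏ i ∈ S, x i) *
        (x k * ((x k - x j) / ((x k - x j) ^ 2 + 1 / ((N : ℝ) + 1))))) = 0 := fun j hj => by
      rw [aomoto_term_of_mem hj hk, mul_zero]
    rw [← aomoto_regularized hγ h0 h1 ha hk, mul_comm 2 γ, mul_assoc, Finset.mul_sum _ _ 2,
      ← Finset.sum_sdiff hsub, Finset.sum_eq_zero hz, add_zero]
    congr 2
    exact Finset.sum_congr rfl fun j hj =>
      (aomoto_term_of_notMem hγ h0 h1 ha one_pos (Finset.mem_sdiff.1 hj).2 hk).symm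
  have l1 : ∀ T : Finset (Fin n), Tendsto (fun N : ℕ =>
      laguerreIntegral γ (1 / ((N : ℝ) + 1)) a 1 (fun x => ∏ i ∈ T, x i)) atTop
      (𝓝 (laguerreIntegral γ 0 a 1 (fun x => ∏ i ∈ T, x i))) := fun T =>
    tendsto_laguerreIntegral hγ ha one_pos (fun N => by fun_prop) 1 (m := n) (by positivity)
      (fun N x hx => by rw [one_mul]; exact abs_prod_le hx)
      (ae_of_all _ fun x => tendsto_const_nhds)
  -- As `ε → 0` the quotient tends to `1` off the null set of coinciding coordinates, so each of the
  -- `n - 1 - |S|` remaining indices contributes `γ`.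
  have l2 : ∀ j ∈ (Finset.univ.erase k) \ S, Tendsto (fun N : ℕ =>
      laguerreIntegral γ (1 / ((N : ℝ) + 1)) a 1 (fun x => (∏ i ∈ S, x i) *
            ((x k - x j) ^ 2 / ((x k - x j) ^ 2 + 1 / ((N : ℝ) + 1))))) atTop
      (𝓝 (laguerreIntegral γ 0 a 1 (fun x => ∏ i ∈ S, x i))) := by
    intro j hj
    have hjk : k ≠ j := (Finset.ne_of_mem_erase (Finset.mem_sdiff.1 hj).1).symm
    refine tendsto_laguerreIntegral hγ ha one_pos (fun N => by fun_prop) 1 (m := n + 0)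
      (by positivity) (fun N x hx => abs_mul_le_of_le hx (abs_prod_le hx) ?_) ?_
    · have h0 := (hε N).1
      rw [Real.rpow_zero, mul_one, abs_of_nonneg (by positivity), div_le_one (by positivity)]
      linarith
    · filter_upwards [ae_orthant_ne n] with x hx
      have hne : (x k - x j) ^ 2 ≠ 0 := pow_ne_zero _ (sub_ne_zero.2 (hx k j hjk))
      have : Tendsto (fun N : ℕ => (∏ i ∈ S, x i) *
          ((x k - x j) ^ 2 / ((x k - x j) ^ 2 + 1 / ((N : ℝ) + 1)))) atTop
          (𝓝 ((∏ i ∈ S, x i) * ((x k - x j) ^ 2 / ((x k - x j) ^ 2 + 0)))) :=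
        tendsto_const_nhds.mul (tendsto_const_nhds.div
          (tendsto_const_nhds.add tendsto_one_div_add_atTop_nhds_zero_nat) (by simpa using hne))
      simpa [div_self hne] using this
  have hlim := (((l1 S).const_mul a).sub (l1 (insert k S))).add
    ((tendsto_finsetSum _ l2).const_mul γ)
  simp only [hreg] at hlim
  have h0 := tendsto_nhds_unique hlim tendsto_const_nhds
  rw [Finset.sum_const, nsmul_eq_mul] at h0
  have hcard : (((Finset.univ.erase k) \ S).card : ℝ) = (n : ℝ) - 1 - S.card := by
    have hsub : S ⊆ Finset.univ.erase k := fun i hi =>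
      Finset.mem_erase.2 ⟨fun h => hk (h ▸ hi), Finset.mem_univ i⟩
    have h1 := Finset.card_sdiff_add_card_eq_card hsub
    have h2 : (Finset.univ.erase k).card + 1 = n := by
      rw [Finset.card_erase_add_one (Finset.mem_univ k)]; simp
    have h3 : ((((Finset.univ.erase k) \ S).card + S.card + 1 : ℕ) : ℝ) = n := by
      rw [h1, h2]
    push_cast at h3
    linarith
  rw [hcard] at h0
  linarith

theorem laguerreIntegral_prod (hγ : 0 ≤ γ) (ha : 0 < a) (S : Finset (Fin n)) :
    laguerreIntegral γ 0 a 1 (fun x => ∏ i ∈ S, x i)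
      = (∏ j ∈ Finset.range S.card, (a + γ * ((n : ℝ) - 1 - j)))
        * laguerreIntegral γ 0 a 1 (fun _ : Fin n → ℝ => 1) := by
  induction S using Finset.induction_on with
  | empty => simp
  | insert k S hk ih =>
    rw [aomoto hγ ha hk, ih, Finset.card_insert_of_notMem hk, Finset.prod_range_succ]
    ring

end

/-! ### The partition function of the Laguerre ensemble -/

instance (n : ℕ) : NeZero (orthant n) := by
  refine ⟨fun h => ?_⟩
  have h1 : orthant n Set.univ = 0 := by rw [h]; simp
  rw [orthant, Measure.pi_univ, Finset.prod_eq_zero_iff] at h1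
  obtain ⟨i, -, hi⟩ := h1
  simp at hi

/-- The partition function of the Laguerre ensemble. -/
def partitionFunction (n : ℕ) (γ a b : ℝ) : ℝ :=
  ∫ x, laguerreWeight a b x * repulsion γ 0 x ∂orthant n

/-- The unnormalized law of the Laguerre ensemble. -/
def ensemble (n : ℕ) (γ a b : ℝ) : Measure (Fin n → ℝ) :=
  (orthant n).withDensity fun x => ENNReal.ofReal (laguerreWeight a b x * repulsion γ 0 x)

section

variable {n : ℕ} {γ a b : ℝ}

theorem density_nonneg_ae : 0 ≤ᵐ[orthant n] fun x => laguerreWeight a b x * repulsion γ 0 x := by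
  filter_upwards [ae_orthant_pos n] with x hx
  exact mul_nonneg (laguerreWeight_pos hx a b).le (repulsion_nonneg le_rfl)

theorem integrable_density (hγ : 0 ≤ γ) (ha : 0 < a) (hb : 0 < b) :
    Integrable (fun x => laguerreWeight a b x * repulsion γ 0 x) (orthant n) := by
  have := integrable_mul_weight (n := n) (p := fun _ => 1) hγ le_rfl zero_le_one ha hb
    measurable_const 1 (m := 0) le_rfl (fun x _ => by simp)
  simpa using this

theorem partitionFunction_pos (hγ : 0 ≤ γ) (ha : 0 < a) (hb : 0 < b) :
    0 < partitionFunction n γ a b := by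
  refine lt_of_le_of_ne (integral_nonneg_of_ae density_nonneg_ae) fun h => ?_
  have h0 := (integral_eq_zero_iff_of_nonneg_ae density_nonneg_ae
    (integrable_density hγ ha hb)).1 h.symm
  have hf : ∀ᵐ x ∂orthant n, False := by
    filter_upwards [h0, ae_orthant_pos n, ae_orthant_ne n] with x h1 h2 h3
    exact (mul_pos (laguerreWeight_pos h2 a b) (repulsion_zero_pos h3)).ne' h1
  exact hf.exists.elim fun _ h => h

theorem partitionFunction_add_one (hγ : 0 ≤ γ) (ha : 0 < a) :
    partitionFunction n γ (a + 1) 1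
      = (∏ j ∈ Finset.range n, (a + γ * j)) * partitionFunction n γ a 1 := by
  have h := laguerreIntegral_prod (n := n) hγ ha Finset.univ
  rw [Finset.card_univ, Fintype.card_fin] at h
  have e1 : laguerreIntegral γ 0 a 1 (fun x : Fin n → ℝ => ∏ i, x i)
      = partitionFunction n γ (a + 1) 1 := by
    refine integral_congr_ae ?_
    filter_upwards [ae_orthant_pos n] with x hx
    rw [← mul_assoc, laguerreWeight, laguerreWeight, ← Finset.prod_mul_distrib]
    congr 1
    refine Finset.prod_congr rfl fun i _ => ?_
    rw [← mul_assoc, mul_comm (x i), ← Real.rpow_add_one (hx i).ne', sub_add_cancel,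
      add_sub_cancel_right]
  have e2 : laguerreIntegral γ 0 a 1 (fun _ : Fin n → ℝ => 1) = partitionFunction n γ a 1 := by
    simp [laguerreIntegral, partitionFunction]
  rw [e1, e2] at h
  -- The substitution `j ↦ n - 1 - j` reverses the order of Aomoto's factors.
  rw [h, ← Finset.prod_range_reflect]
  congr 1
  refine Finset.prod_congr rfl fun j hj => ?_
  have := Finset.mem_range.1 hj
  rw [Nat.sub_sub, Nat.cast_sub (by omega)]
  push_cast
  ring

theorem integrable_ensemble_iff {f : (Fin n → ℝ) → ℝ} :
    Integrable f (ensemble n γ a b) ↔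
      Integrable (fun x => f x * (laguerreWeight a b x * repulsion γ 0 x)) (orthant n) := by
  rw [ensemble, integrable_withDensity_iff (by fun_prop) (ae_of_all _ fun x => by simp)]
  refine integrable_congr ?_
  filter_upwards [density_nonneg_ae (n := n) (γ := γ) (a := a) (b := b)] with x hx
  rw [ENNReal.toReal_ofReal hx]

theorem integral_ensemble (f : (Fin n → ℝ) → ℝ) :
    ∫ x, f x ∂ensemble n γ a b
      = ∫ x, f x * (laguerreWeight a b x * repulsion γ 0 x) ∂orthant n := by
  rw [ensemble, integral_withDensity_eq_integral_toReal_smul (by fun_prop)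
    (ae_of_all _ fun x => by simp)]
  refine integral_congr_ae ?_
  filter_upwards [density_nonneg_ae (n := n) (γ := γ) (a := a) (b := b)] with x hx
  rw [ENNReal.toReal_ofReal hx, smul_eq_mul, mul_comm]

/-- Tilting by the log-determinant and the trace stays within the Laguerre family; this is what
makes the Laplace transforms computable. -/
theorem exp_mul_density_ae (u v : ℝ) :
    (fun x => Real.exp (u * ∑ i, Real.log (x i) + v * ∑ i, x i) *
      (laguerreWeight a b x * repulsion γ 0 x))
    =ᵐ[orthant n] fun x => laguerreWeight (a + u) (b - v) x * repulsion γ 0 x := by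
  filter_upwards [ae_orthant_pos n] with x hx
  rw [← mul_assoc, Finset.mul_sum, Finset.mul_sum, ← Finset.sum_add_distrib, Real.exp_sum,
    laguerreWeight, laguerreWeight, ← Finset.prod_mul_distrib]
  congr 1
  refine Finset.prod_congr rfl fun i _ => ?_
  rw [Real.rpow_def_of_pos (hx i), Real.rpow_def_of_pos (hx i), ← Real.exp_add, ← Real.exp_add,
    ← Real.exp_add]
  congr 1
  ring

theorem integrable_exp_ensemble (hγ : 0 ≤ γ) {u v : ℝ} (hu : 0 < a + u) (hv : 0 < b - v) :
    Integrable (fun x => Real.exp (u * ∑ i, Real.log (x i) + v * ∑ i, x i))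
      (ensemble n γ a b) := by
  rw [integrable_ensemble_iff, integrable_congr (exp_mul_density_ae u v)]
  exact integrable_density hγ hu hv

theorem integral_exp_ensemble (u v : ℝ) :
    ∫ x, Real.exp (u * ∑ i, Real.log (x i) + v * ∑ i, x i) ∂ensemble n γ a b
      = partitionFunction n γ (a + u) (b - v) := by
  rw [integral_ensemble, integral_congr_ae (exp_mul_density_ae u v), partitionFunction]

theorem ensemble_univ (hγ : 0 ≤ γ) (ha : 0 < a) (hb : 0 < b) :
    ensemble n γ a b Set.univ = ENNReal.ofReal (partitionFunction n γ a b) := by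
  rw [ensemble, withDensity_apply _ MeasurableSet.univ, Measure.restrict_univ, partitionFunction,
    ofReal_integral_eq_lintegral_ofReal (integrable_density hγ ha hb) density_nonneg_ae]

/-- Up to a shift of the variable this is the cumulant generating function of `∑ ln x_i` under the
ensemble with `a = b = 1`, whose second derivative is a variance under a tilted law. -/
theorem convexOn_log_partitionFunction (hγ : 0 ≤ γ) :
    ConvexOn ℝ (Set.Ioi 0) fun a => Real.log (partitionFunction n γ a 1) := by
  set X : (Fin n → ℝ) → ℝ := fun x => ∑ i, Real.log (x i) with hX
  set μ := ensemble n γ 1 1 with hμ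
  have hsub : Set.Ioi (-1 : ℝ) ⊆ interior (integrableExpSet X μ) := by
    rw [isOpen_Ioi.subset_interior_iff]
    intro u hu
    have hu : -1 < u := hu
    have := integrable_exp_ensemble (n := n) (a := 1) (b := 1) hγ (u := u) (v := 0)
      (by linarith) (by norm_num)
    simpa [integrableExpSet] using this
  have hmem : ∀ a ∈ Set.Ioi (0 : ℝ), a - 1 ∈ interior (integrableExpSet X μ) := fun a ha =>
    hsub (by have : (0 : ℝ) < a := ha
             exact Set.mem_Ioi.2 (by linarith))
  have hana : AnalyticOnNhd ℝ (fun a => cgf X μ (a - 1)) (Set.Ioi 0) := fun a ha =>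
    (analyticAt_cgf (hmem a ha)).fun_comp (f := fun a => a - 1) (by fun_prop)
  have hconv : ConvexOn ℝ (Set.Ioi 0) fun a => cgf X μ (a - 1) := by
    refine convexOn_of_deriv2_nonneg' (convex_Ioi 0) hana.differentiableOn
      hana.deriv.differentiableOn fun a ha => ?_
    rw [← iteratedDeriv_eq_iterate, iteratedDeriv_comp_sub_const]
    change 0 ≤ iteratedDeriv 2 (cgf X μ) (a - 1)
    rw [iteratedDeriv_two_cgf_eq_integral (hmem a ha)]
    exact div_nonneg (integral_nonneg fun x => by positivity) mgf_nonneg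
  refine hconv.congr fun a ha => ?_
  have := integral_exp_ensemble (n := n) (γ := γ) (a := 1) (b := 1) (a - 1) 0
  simp only [zero_mul, add_zero, sub_zero, add_sub_cancel] at this
  simp only [cgf, mgf, hX, hμ, this]

theorem convexOn_sum_logGamma (hγ : 0 ≤ γ) :
    ConvexOn ℝ (Set.Ioi 0) fun a => ∑ j ∈ Finset.range n, logGamma (a + γ * j) := by
  refine ⟨convex_Ioi 0, fun x hx y hy s t hs ht hst => ?_⟩
  have hx : 0 < x := hx
  have hy : 0 < y := hy
  simp only [smul_eq_mul, Finset.mul_sum, ← Finset.sum_add_distrib]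
  refine Finset.sum_le_sum fun j _ => ?_
  have h0 : 0 ≤ γ * (j : ℝ) := by positivity
  have := convexOn_logGamma.2 (Set.mem_Ioi.2 (by linarith : 0 < x + γ * j))
    (Set.mem_Ioi.2 (by linarith : 0 < y + γ * j)) hs ht hst
  simp only [smul_eq_mul] at this
  convert this using 2
  linear_combination -(γ * j) * hst

/-- The ratio of partition functions with different exponents, by Krull's theorem. -/
theorem log_partitionFunction_sub (hγ : 0 ≤ γ) {a₁ a₂ : ℝ} (h₁ : 0 < a₁) (h₂ : 0 < a₂) :
    Real.log (partitionFunction n γ a₁ 1) - ∑ j ∈ Finset.range n, logGamma (a₁ + γ * j)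
      = Real.log (partitionFunction n γ a₂ 1)
        - ∑ j ∈ Finset.range n, logGamma (a₂ + γ * j) := by
  have hpos : ∀ x : ℝ, 0 < x → ∀ j : ℕ, 0 < x + γ * j := fun x hx j => by positivity
  refine krull_uniqueness (h := fun a => ∑ j ∈ Finset.range n, Real.log (a + γ * j))
    (g₁ := fun a => Real.log (partitionFunction n γ a 1))
    (g₂ := fun a => ∑ j ∈ Finset.range n, logGamma (a + γ * j))
    (convexOn_log_partitionFunction hγ) (convexOn_sum_logGamma hγ) (fun x hx => ?_)
    (fun x hx => ?_) ?_ h₁ h₂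
  · rw [partitionFunction_add_one hγ hx, Real.log_mul
      (Finset.prod_ne_zero_iff.2 fun j _ => (hpos x hx j).ne')
      (partitionFunction_pos hγ hx one_pos).ne', Real.log_prod fun j _ => (hpos x hx j).ne',
      add_comm]
  · rw [← Finset.sum_add_distrib]
    refine Finset.sum_congr rfl fun j _ => ?_
    rw [← logGamma_add_one (hpos x hx j)]
    congr 1
    ring
  -- Krull's hypothesis holds because `ln (x + 1) - ln x → 0`, term by term.
  · simp only [← Finset.sum_sub_distrib]
    rw [← Finset.sum_const_zero (s := Finset.range n) (M := ℝ)]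
    refine tendsto_finsetSum _ fun j _ => ?_
    have h := (Real.tendsto_log_comp_add_sub_log 1).comp
      (tendsto_atTop_add_const_right atTop (γ * (j : ℝ)) tendsto_id)
    refine h.congr fun x => ?_
    simp only [Function.comp_apply, id]
    congr 2
    ring

theorem laguerreWeight_smul (hb : 0 < b) {x : Fin n → ℝ} (hx : ∀ i, 0 < x i) :
    laguerreWeight a 1 (b • x) = b ^ ((n : ℝ) * (a - 1)) * laguerreWeight a b x := by
  have : b ^ ((n : ℝ) * (a - 1)) = ∏ _i : Fin n, b ^ (a - 1) := by
    rw [Finset.prod_const, Finset.card_univ, Fintype.card_fin, ← Real.rpow_natCast,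
      ← Real.rpow_mul hb.le, mul_comm]
  rw [this, laguerreWeight, laguerreWeight, ← Finset.prod_mul_distrib]
  refine Finset.prod_congr rfl fun i _ => ?_
  rw [Pi.smul_apply, smul_eq_mul, Real.mul_rpow hb.le (hx i).le, one_mul, mul_assoc]

theorem repulsion_smul (hb : 0 < b) (x : Fin n → ℝ) :
    repulsion γ 0 (b • x) = b ^ (γ * (n * (n - 1))) * repulsion γ 0 x := by
  have : b ^ (γ * ((n : ℝ) * (n - 1))) = ∏ i : Fin n, ∏ _j ∈ Finset.univ.erase i, b ^ γ := by
    rcases Nat.eq_zero_or_pos n with rfl | hn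
    · simp
    simp only [Finset.prod_const, Finset.card_erase_of_mem (Finset.mem_univ _), Finset.card_univ,
      Fintype.card_fin]
    rw [← pow_mul, ← Real.rpow_natCast, ← Real.rpow_mul hb.le]
    push_cast [Nat.cast_sub hn]
    congr 1
    ring
  rw [this, repulsion, repulsion, ← Finset.prod_mul_distrib]
  refine Finset.prod_congr rfl fun i _ => ?_
  rw [← Finset.prod_mul_distrib]
  refine Finset.prod_congr rfl fun j _ => ?_
  simp only [Pi.smul_apply, smul_eq_mul, add_zero]
  rw [← mul_sub, mul_pow, Real.mul_rpow (by positivity) (by positivity), ← Real.rpow_two,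
    ← Real.rpow_mul hb.le]
  congr 2
  ring

-- Under `x ↦ b x` the weight contributes `n (a - 1)` powers of `b`, the interaction `γ n (n - 1)`
-- and Lebesgue measure `n`.
open scoped Pointwise in
theorem log_partitionFunction_scale (hγ : 0 ≤ γ) (ha : 0 < a) (hb : 0 < b) :
    Real.log (partitionFunction n γ a b) = Real.log (partitionFunction n γ a 1)
      - (n * a + γ * (n * (n - 1))) * Real.log b := by
  have h1 : ∫ x, (laguerreWeight a 1 (b • x) * repulsion γ 0 (b • x)) ∂orthant n
      = (b ^ n)⁻¹ * partitionFunction n γ a 1 := by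
    have hs : b • {x : Fin n → ℝ | ∀ i, 0 < x i} = {x | ∀ i, 0 < x i} := by
      ext x
      rw [Set.mem_smul_set_iff_inv_smul_mem₀ hb.ne']
      simp [hb]
    rw [orthant_eq_restrict, Measure.setIntegral_comp_smul_of_pos _
      (fun x : Fin n → ℝ => laguerreWeight a 1 x * repulsion γ 0 x) _ hb, hs,
      partitionFunction, orthant_eq_restrict]
    simp
  have h2 : ∫ x, (laguerreWeight a 1 (b • x) * repulsion γ 0 (b • x)) ∂orthant n
      = (b ^ ((n : ℝ) * (a - 1)) * b ^ (γ * (n * (n - 1)))) * partitionFunction n γ a b := by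
    rw [partitionFunction, ← integral_const_mul]
    refine integral_congr_ae ?_
    filter_upwards [ae_orthant_pos n] with x hx
    rw [laguerreWeight_smul hb hx, repulsion_smul hb]
    ring
  have h3 := congrArg Real.log (h2.symm.trans h1)
  have p1 := (partitionFunction_pos (n := n) hγ ha hb).ne'
  have p2 := (partitionFunction_pos (n := n) hγ ha one_pos).ne'
  have q : ∀ r : ℝ, b ^ r ≠ 0 := fun r => (Real.rpow_pos_of_pos hb r).ne'
  rw [Real.log_mul (mul_ne_zero (q _) (q _)) p1, Real.log_mul (q _) (q _),
    Real.log_mul (inv_ne_zero (pow_ne_zero _ hb.ne')) p2, Real.log_inv, Real.log_pow,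
    Real.log_rpow hb, Real.log_rpow hb] at h3
  linear_combination h3

/-- The exact ratio of partition functions. -/
theorem log_partitionFunction_ratio (hγ : 0 ≤ γ) {a' b' : ℝ} (ha : 0 < a) (hb : 0 < b)
    (ha' : 0 < a') (hb' : 0 < b') :
    Real.log (partitionFunction n γ a' b') - Real.log (partitionFunction n γ a b)
      = ∑ j ∈ Finset.range n, (logGamma (a' + γ * j) - logGamma (a + γ * j))
        - (n * a' + γ * (n * (n - 1))) * Real.log b'
        + (n * a + γ * (n * (n - 1))) * Real.log b := by
  rw [log_partitionFunction_scale hγ ha hb, log_partitionFunction_scale hγ ha' hb',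
    Finset.sum_sub_distrib]
  linear_combination log_partitionFunction_sub (n := n) hγ ha' ha

end

/-! ### The law of the eigenvalues and exact generating functions -/

section

variable {n : ℕ} {β c : ℝ}

/-- The `1/n` terms of `α` are such that `β n α = a - 1` with `a = β / 2 * (n (c - 1) + 1)`. The sum
over ordered pairs with its factor `1/2` produces `|x_i - x_j| ^ β` for each unordered pair, hence
`γ = β / 2`. -/
theorem gibbs_eq_ensemble (hβ : 0 < β) (hn : 1 ≤ n) :
    gibbs β c n = ensemble n (β / 2) (β / 2 * (n * (c - 1) + 1)) (β * n / 2) := by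
  have hn0 : (n : ℝ) ≠ 0 := by positivity
  rw [gibbs, ensemble, ← orthant_eq_restrict]
  refine withDensity_congr_ae ?_
  filter_upwards [ae_orthant_pos n, ae_orthant_ne n] with x hx hne
  congr 1
  have e1 : laguerreWeight (β / 2 * (n * (c - 1) + 1)) (β * n / 2) x
      = Real.exp (∑ i, ((β / 2 * (n * (c - 1) + 1) - 1) * Real.log (x i) - β * n / 2 * x i)) := by
    rw [Real.exp_sum, laguerreWeight]
    refine Finset.prod_congr rfl fun i _ => ?_
    rw [Real.rpow_def_of_pos (hx i), ← Real.exp_add]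
    congr 1
    ring
  have e2 : repulsion (β / 2) 0 x
      = Real.exp (∑ i, ∑ j ∈ Finset.univ.erase i, β / 2 * Real.log |x i - x j|) := by
    rw [Real.exp_sum]
    refine Finset.prod_congr rfl fun i _ => ?_
    rw [Real.exp_sum]
    refine Finset.prod_congr rfl fun j hj => ?_
    have hd : x i - x j ≠ 0 := sub_ne_zero.2 (hne i j (Finset.ne_of_mem_erase hj).symm)
    rw [add_zero, Real.rpow_def_of_pos (by positivity), Real.log_abs, Real.log_pow]
    congr 1
    push_cast
    ring
  rw [e1, e2, ← Real.exp_add, energy]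
  congr 1
  have e3 : ∀ i, potential β c n (x i)
      = -(1 / (β * n)) * ((β / 2 * (n * (c - 1) + 1) - 1) * Real.log (x i)
        - β * n / 2 * x i) := by
    intro i
    rw [potential, alpha]
    field_simp
    ring
  simp only [e3, ← Finset.mul_sum]
  field_simp
  ring

theorem exponent_pos (hβ : 0 < β) (hc : 1 ≤ c) : 0 < β / 2 * ((n : ℝ) * (c - 1) + 1) := by
  have : 0 ≤ c - 1 := by linarith
  positivity

theorem gibbs_univ (hβ : 0 < β) (hc : 1 ≤ c) (hn : 1 ≤ n) :
    gibbs β c n Set.univ = ENNReal.ofReal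
      (partitionFunction n (β / 2) (β / 2 * (n * (c - 1) + 1)) (β * n / 2)) := by
  rw [gibbs_eq_ensemble hβ hn, ensemble_univ (by positivity) (exponent_pos hβ hc) (by positivity)]

theorem isProbabilityMeasure_law (hβ : 0 < β) (hc : 1 ≤ c) (hn : 1 ≤ n) :
    IsProbabilityMeasure (law β c n) := by
  refine ⟨?_⟩
  have hZ := partitionFunction_pos (n := n) (γ := β / 2) (b := β * n / 2) (by positivity)
    (exponent_pos (n := n) hβ hc) (by positivity)
  rw [law, Measure.smul_apply, smul_eq_mul, gibbs_univ hβ hc hn]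
  exact ENNReal.inv_mul_cancel (by simpa using hZ) ENNReal.ofReal_ne_top

/-- The generating function of the cumulants of `H` at finite `n`. -/
def finiteJH (β c : ℝ) (n : ℕ) (s : ℝ) : ℝ :=
  -s * Real.log (β * n / 2) - 1 / (β * (n : ℝ) ^ 2) * ∑ j ∈ Finset.range n,
    (logGamma (β / 2 * (n * (c - 1 - 2 * s) + (j + 1)))
      - logGamma (β / 2 * (n * (c - 1) + (j + 1))))

theorem exp_joint_eq (hn : 1 ≤ n) (s w : ℝ) (x : Fin n → ℝ) :
    Real.exp (-(β * (n : ℝ) ^ 2 * (s * logDet n x + w * totalVar n x)))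
      = Real.exp ((-(β * n * s)) * ∑ i, Real.log (x i) + (-(β * n * w)) * ∑ i, x i) := by
  have hn0 : (n : ℝ) ≠ 0 := by positivity
  congr 1
  rw [logDet, totalVar]
  field_simp
  ring

/-- The `+ 1` leaves room for the boundary value `s = s_c`, where `c - 1 - 2 s = 0`. -/
theorem shifted_exponent_pos (hβ : 0 < β) {s : ℝ} (hs : 0 < n * (c - 1 - 2 * s) + 1) :
    0 < β / 2 * ((n : ℝ) * (c - 1) + 1) + -(β * n * s) := by
  have : β / 2 * ((n : ℝ) * (c - 1) + 1) + -(β * n * s)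
      = β / 2 * (n * (c - 1 - 2 * s) + 1) := by ring
  rw [this]
  positivity

theorem shifted_rate_pos (hβ : 0 < β) (hn : 1 ≤ n) {w : ℝ} (hw : -(1 / 2) < w) :
    0 < β * n / 2 - -(β * n * w) := by
  have : β * n / 2 - -(β * n * w) = β * n * (1 / 2 + w) := by ring
  rw [this]
  have : 0 < 1 / 2 + w := by linarith
  positivity

theorem integrable_exp_joint (hβ : 0 < β) (hc : 1 ≤ c) (hn : 1 ≤ n) {s w : ℝ}
    (hs : 0 < n * (c - 1 - 2 * s) + 1) (hw : -(1 / 2) < w) :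
    Integrable (fun x => Real.exp (-(β * (n : ℝ) ^ 2 * (s * logDet n x + w * totalVar n x))))
      (law β c n) := by
  simp only [exp_joint_eq hn]
  rw [law]
  refine Integrable.smul_measure ?_ ?_
  · rw [gibbs_eq_ensemble hβ hn]
    exact integrable_exp_ensemble (by positivity) (shifted_exponent_pos hβ hs)
      (shifted_rate_pos hβ hn hw)
  · have hZ := partitionFunction_pos (n := n) (γ := β / 2) (b := β * n / 2) (by positivity)
      (exponent_pos (n := n) hβ hc) (by positivity)
    rw [gibbs_univ hβ hc hn]
    simpa using hZ

/-- The exact joint cumulant generating function of `(H, T)`. -/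
theorem log_integral_exp_joint (hβ : 0 < β) (hc : 1 ≤ c) (hn : 1 ≤ n) {s w : ℝ}
    (hs : 0 < n * (c - 1 - 2 * s) + 1) (hw : -(1 / 2) < w) :
    Real.log (∫ x, Real.exp (-(β * (n : ℝ) ^ 2 * (s * logDet n x + w * totalVar n x)))
      ∂law β c n)
    = -(β * (n : ℝ) ^ 2) * (finiteJH β c n s + JT c w - s * Real.log (1 + 2 * w)) := by
  have hγ : 0 ≤ β / 2 := by positivity
  have ha := exponent_pos (n := n) hβ hc
  have hb : 0 < β * n / 2 := by positivity
  have ha' := shifted_exponent_pos hβ hs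
  have hb' := shifted_rate_pos hβ hn hw
  have hZ := partitionFunction_pos (n := n) hγ ha hb
  have hZ' := partitionFunction_pos (n := n) hγ ha' hb'
  have hn0 : (n : ℝ) ≠ 0 := by positivity
  simp only [exp_joint_eq hn]
  rw [law, integral_smul_measure, gibbs_univ hβ hc hn, gibbs_eq_ensemble hβ hn,
    integral_exp_ensemble, smul_eq_mul, ENNReal.toReal_inv, ENNReal.toReal_ofReal hZ.le,
    Real.log_mul (inv_ne_zero hZ.ne') hZ'.ne', Real.log_inv, neg_add_eq_sub,
    log_partitionFunction_ratio hγ ha hb ha' hb']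
  have e1 : β * n / 2 - -(β * n * w) = β * n / 2 * (1 + 2 * w) := by ring
  have hw' : 1 + 2 * w ≠ 0 := by linarith
  have e2 : ∀ j : ℕ, β / 2 * ((n : ℝ) * (c - 1) + 1) + -(β * n * s) + β / 2 * j
      = β / 2 * (n * (c - 1 - 2 * s) + (j + 1)) := fun j => by ring
  have e3 : ∀ j : ℕ, β / 2 * ((n : ℝ) * (c - 1) + 1) + β / 2 * j
      = β / 2 * (n * (c - 1) + (j + 1)) := fun j => by ring
  simp only [e1, e2, e3]
  -- The scaling exponent for the shifted `a` is exactly `β n² (c / 2 - s)`, so the terms in `w`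
  -- carry no `1/n` corrections.
  rw [Real.log_mul hb.ne' hw', finiteJH, JT]
  field_simp
  ring

/-- The generating function of the cumulants of `L` at finite `n`. -/
def finiteJL (β c : ℝ) (n : ℕ) (s : ℝ) : ℝ :=
  JT c s + finiteJH β c n (-s) + (s * Real.log (1 + 2 * s) - s)

theorem exp_likelihoodRatio_eq (s : ℝ) (x : Fin n → ℝ) :
    Real.exp (-(β * (n : ℝ) ^ 2 * s * likelihoodRatio n x))
      = Real.exp (β * (n : ℝ) ^ 2 * s) *
        Real.exp (-(β * (n : ℝ) ^ 2 * (-s * logDet n x + s * totalVar n x))) := by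
  rw [← Real.exp_add, likelihoodRatio]
  congr 1
  ring

theorem integrable_exp_likelihoodRatio (hβ : 0 < β) (hc : 1 ≤ c) (hn : 1 ≤ n) {s : ℝ}
    (hs : 0 < n * (c - 1 + 2 * s) + 1) (hs' : -(1 / 2) < s) :
    Integrable (fun x => Real.exp (-(β * (n : ℝ) ^ 2 * s * likelihoodRatio n x)))
      (law β c n) := by
  simp only [exp_likelihoodRatio_eq]
  refine (integrable_exp_joint hβ hc hn ?_ hs').const_mul _
  rwa [mul_neg, sub_neg_eq_add]

theorem log_integral_exp_likelihoodRatio (hβ : 0 < β) (hc : 1 ≤ c) (hn : 1 ≤ n) {s : ℝ}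
    (hs : 0 < n * (c - 1 + 2 * s) + 1) (hs' : -(1 / 2) < s) :
    Real.log (∫ x, Real.exp (-(β * (n : ℝ) ^ 2 * s * likelihoodRatio n x)) ∂law β c n)
      = -(β * (n : ℝ) ^ 2) * finiteJL β c n s := by
  have := isProbabilityMeasure_law hβ hc hn
  have hs1 : 0 < n * (c - 1 - 2 * -s) + 1 := by rwa [mul_neg, sub_neg_eq_add]
  have hpos : 0 < ∫ x, Real.exp (-(β * (n : ℝ) ^ 2 * (-s * logDet n x + s * totalVar n x)))
      ∂law β c n := integral_exp_pos (integrable_exp_joint hβ hc hn hs1 hs')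
  simp only [exp_likelihoodRatio_eq]
  rw [integral_const_mul, Real.log_mul (Real.exp_pos _).ne' hpos.ne', Real.log_exp,
    log_integral_exp_joint hβ hc hn hs1 hs', finiteJL]
  ring

/-! ### Cumulants at finite `n` -/

theorem finiteJH_zero : finiteJH β c n 0 = 0 := by simp [finiteJH]

/-- Near `0` all generating functions are given by their formulas. -/
theorem eventually_mem_domain (hc : 1 < c) (a : ℝ) (n : ℕ) :
    ∀ᶠ u in 𝓝 (0 : ℝ), -(1 / 2) < a * u ∧ 0 < n * (c - 1 - 2 * (a * u)) + 1 ∧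
      0 < n * (c - 1 + 2 * (a * u)) + 1 := by
  have hlim : Tendsto (fun u : ℝ => |a * u|) (𝓝 0) (𝓝 0) := by
    have : Continuous fun u : ℝ => |a * u| := by fun_prop
    simpa using this.tendsto 0
  have hc' : 0 < (c - 1) / 2 := by linarith
  filter_upwards [hlim.eventually (gt_mem_nhds hc'),
    hlim.eventually (gt_mem_nhds (by norm_num : (0 : ℝ) < 1 / 2))] with u h1 h2
  rw [abs_lt] at h1 h2
  have h3 : 0 < c - 1 - 2 * (a * u) := by linarith [h1.2]
  have h4 : 0 < c - 1 + 2 * (a * u) := by linarith [h1.1]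
  exact ⟨h2.1, by positivity, by positivity⟩

/-- The Laplace variable `s` and the variable `u` of the cumulant generating function are related by
`u = -N s`; below, `N = β n²`. -/
theorem cgf_eventuallyEq_of {μ : Measure (Fin n → ℝ)} {X : (Fin n → ℝ) → ℝ} {g : ℝ → ℝ} {N : ℝ}
    (hN : N ≠ 0)
    (h : ∀ᶠ u in 𝓝 (0 : ℝ), Real.log (∫ x, Real.exp (-(N * ((-1 / N) * u) * X x)) ∂μ)
      = -N * g ((-1 / N) * u)) :
    cgf X μ =ᶠ[𝓝 0] fun u => -N * g ((-1 / N) * u) := by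
  filter_upwards [h] with u hu
  rw [← hu, cgf, mgf]
  congr 2
  ext x
  field_simp

/-- The chain rule gives `-N (-1 / N) ^ l`, which the prefactor cancels: this is the origin of the
normalization `(-β n²) ^ (ℓ - 1)`. -/
theorem pow_mul_iteratedDeriv_of_eventuallyEq {f g : ℝ → ℝ} {N : ℝ} (hN : N ≠ 0)
    (h : f =ᶠ[𝓝 0] fun u => -N * g ((-1 / N) * u)) {l : ℕ} (hl : 1 ≤ l) :
    (-N) ^ (l - 1) * iteratedDeriv l f 0 = iteratedDeriv l g 0 := by
  rw [h.iteratedDeriv_eq, iteratedDeriv_const_mul_field, iteratedDeriv_comp_mul_left]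
  simp only [mul_zero]
  rw [← mul_assoc, ← pow_succ, Nat.sub_add_cancel hl, ← mul_assoc, ← mul_pow]
  have : -N * (-1 / N) = 1 := by field_simp
  rw [this, one_pow, one_mul]

theorem cgf_likelihoodRatio (hβ : 0 < β) (hc : 1 < c) (hn : 1 ≤ n) :
    cgf (likelihoodRatio n) (law β c n) =ᶠ[𝓝 0] fun u =>
      -(β * (n : ℝ) ^ 2) * finiteJL β c n ((-1 / (β * (n : ℝ) ^ 2)) * u) := by
  refine cgf_eventuallyEq_of (by positivity) ?_
  filter_upwards [eventually_mem_domain hc (-1 / (β * (n : ℝ) ^ 2)) n] with u hu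
  refine log_integral_exp_likelihoodRatio hβ hc.le hn hu.2.2 hu.1

theorem cgf_logDet (hβ : 0 < β) (hc : 1 < c) (hn : 1 ≤ n) :
    cgf (logDet n) (law β c n) =ᶠ[𝓝 0] fun u =>
      -(β * (n : ℝ) ^ 2) * finiteJH β c n ((-1 / (β * (n : ℝ) ^ 2)) * u) := by
  refine cgf_eventuallyEq_of (by positivity) ?_
  filter_upwards [eventually_mem_domain hc (-1 / (β * (n : ℝ) ^ 2)) n] with u hu
  have h := log_integral_exp_joint hβ hc.le hn (w := 0) hu.2.1 (by norm_num)
  simpa [JT, mul_assoc] using h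

theorem cgf_totalVar (hβ : 0 < β) (hc : 1 < c) (hn : 1 ≤ n) :
    cgf (totalVar n) (law β c n) =ᶠ[𝓝 0] fun u =>
      -(β * (n : ℝ) ^ 2) * JT c ((-1 / (β * (n : ℝ) ^ 2)) * u) := by
  refine cgf_eventuallyEq_of (by positivity) ?_
  filter_upwards [eventually_mem_domain hc (-1 / (β * (n : ℝ) ^ 2)) n] with u hu
  have hs : 0 < (n : ℝ) * (c - 1 - 2 * 0) + 1 := by
    have : 0 < c - 1 := by linarith
    rw [mul_zero, sub_zero]
    positivity
  have h := log_integral_exp_joint hβ hc.le hn hs hu.1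
  simpa [finiteJH_zero, mul_assoc] using h

theorem mem_interior_integrableExpSet_of {μ : Measure (Fin n → ℝ)} {X : (Fin n → ℝ) → ℝ} {N : ℝ}
    (hN : N ≠ 0)
    (h : ∀ᶠ u in 𝓝 (0 : ℝ), Integrable (fun x => Real.exp (-(N * ((-1 / N) * u) * X x))) μ) :
    0 ∈ interior (integrableExpSet X μ) := by
  rw [mem_interior_iff_mem_nhds]
  filter_upwards [h] with u hu
  have e : ∀ x, -(N * ((-1 / N) * u) * X x) = u * X x := fun x => by field_simp
  simp only [e] at hu
  exact hu

theorem zero_mem_interior_likelihoodRatio (hβ : 0 < β) (hc : 1 < c) (hn : 1 ≤ n) :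
    0 ∈ interior (integrableExpSet (likelihoodRatio n) (law β c n)) := by
  refine mem_interior_integrableExpSet_of (N := β * (n : ℝ) ^ 2) (by positivity) ?_
  filter_upwards [eventually_mem_domain hc (-1 / (β * (n : ℝ) ^ 2)) n] with u hu
  refine integrable_exp_likelihoodRatio hβ hc.le hn hu.2.2 hu.1

theorem zero_mem_interior_logDet (hβ : 0 < β) (hc : 1 < c) (hn : 1 ≤ n) :
    0 ∈ interior (integrableExpSet (logDet n) (law β c n)) := by
  refine mem_interior_integrableExpSet_of (N := β * (n : ℝ) ^ 2) (by positivity) ?_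
  filter_upwards [eventually_mem_domain hc (-1 / (β * (n : ℝ) ^ 2)) n] with u hu
  have h := integrable_exp_joint hβ hc.le hn (w := 0) hu.2.1 (by norm_num)
  simpa [mul_assoc] using h

theorem zero_mem_interior_totalVar (hβ : 0 < β) (hc : 1 < c) (hn : 1 ≤ n) :
    0 ∈ interior (integrableExpSet (totalVar n) (law β c n)) := by
  refine mem_interior_integrableExpSet_of (N := β * (n : ℝ) ^ 2) (by positivity) ?_
  filter_upwards [eventually_mem_domain hc (-1 / (β * (n : ℝ) ^ 2)) n] with u hu
  have hs : 0 < (n : ℝ) * (c - 1 - 2 * 0) + 1 := by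
    have : 0 < c - 1 := by linarith
    rw [mul_zero, sub_zero]
    positivity
  have h := integrable_exp_joint hβ hc.le hn hs hu.1
  simpa [mul_assoc] using h

end

/-! ### Asymptotics of the generating function of `H` -/

section

variable {β c : ℝ}

/-- Each summand is `ln Γ (-y)` with `y` affine in `s` of slope `β n ≥ 0`, up to a constant, and the
remaining term is linear. -/
theorem higherDerivNonneg_neg_finiteJH (hβ : 0 < β) (n : ℕ) :
    HigherDerivNonneg (fun s => -finiteJH β c n s) (Set.Iio (sc c)) := by
  have hterm : ∀ j ∈ Finset.range n, HigherDerivNonneg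
      (fun s => logGamma (β / 2 * (n * (c - 1 - 2 * s) + (j + 1)))
        - logGamma (β / 2 * (n * (c - 1) + (j + 1)))) (Set.Iio (sc c)) := by
    intro j _
    have h1 := (higherDerivNonneg_logGamma_neg.comp_affine (V := Set.Iio (sc c)) (a := β * n)
      (-(β / 2 * (n * (c - 1) + (j + 1)))) (by positivity) ?_).add
      (HigherDerivNonneg.affine 0 (-logGamma (β / 2 * (n * (c - 1) + (j + 1)))) _)
    · convert h1 using 2 with s
      rw [zero_mul, zero_add, ← sub_eq_add_neg]
      congr 2
      ring
    · intro s hs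
      have hs : s < (c - 1) / 2 := hs
      have h2 : 0 ≤ (n : ℝ) * (c - 1 - 2 * s) := mul_nonneg n.cast_nonneg (by linarith)
      have h3 : 0 < β / 2 * (n * (c - 1 - 2 * s) + (j + 1)) := by positivity
      simp only [Set.mem_Iio]
      linarith
  have h := (HigherDerivNonneg.affine (Real.log (β * n / 2)) 0 (Set.Iio (sc c))).add
    ((HigherDerivNonneg.sum _ hterm).const_mul (a := 1 / (β * (n : ℝ) ^ 2)) (by positivity))
  convert h using 2 with s
  rw [finiteJH]
  ring

theorem analyticOnNhd_phi : AnalyticOnNhd ℝ phi (Set.Iio 0) := by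
  intro x hx
  have hx : x < 0 := hx
  have h1 : AnalyticAt ℝ (fun x : ℝ => Real.log (-2 * x)) x :=
    AnalyticAt.log (by fun_prop) (by linarith)
  have h2 : AnalyticAt ℝ (fun x : ℝ => Real.log (1 - 2 * x)) x :=
    AnalyticAt.log (by fun_prop) (by linarith)
  unfold phi
  fun_prop

theorem analyticOnNhd_JH (c : ℝ) : AnalyticOnNhd ℝ (JH c) (Set.Iio (sc c)) := by
  intro s hs
  have h := analyticOnNhd_phi (s - sc c) (by simpa using hs)
  exact (h.fun_comp (f := fun s => s - sc c) (by fun_prop)).sub analyticAt_const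

/-- A primitive of `x ln x`. -/
def mulLogPrimitive (u : ℝ) : ℝ := u / 2 * (u * Real.log u) - u ^ 2 / 4

/-- Writing the primitive through `u ln u` makes continuity at `0` immediate. -/
theorem continuous_mulLogPrimitive : Continuous mulLogPrimitive := by
  have := Real.continuous_mul_log
  unfold mulLogPrimitive
  fun_prop

theorem hasDerivAt_mulLogPrimitive {u : ℝ} (hu : 0 < u) :
    HasDerivAt mulLogPrimitive (u * Real.log u) u := by
  have h := (((hasDerivAt_id u).div_const 2).mul (Real.hasDerivAt_mul_log hu.ne')).sub
    (((hasDerivAt_id u).pow 2).div_const 4)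
  refine h.congr_deriv ?_
  simp only [id]
  push_cast
  ring

theorem tendsto_log_div_nat : Tendsto (fun n : ℕ => Real.log n / (n : ℝ)) atTop (𝓝 0) := by
  have h := Real.isLittleO_log_id_atTop.tendsto_div_nhds_zero
  exact h.comp tendsto_natCast_atTop_atTop

/-- Asymptotics of `∑ ln Γ` by Stirling's formula and a Riemann sum. -/
theorem tendsto_sum_logGamma (hβ : 0 < β) {t : ℝ} (ht : 0 ≤ t) :
    Tendsto (fun n : ℕ => 1 / (β * (n : ℝ) ^ 2) *
        ∑ j ∈ Finset.range n, logGamma (β / 2 * (n * t + (j + 1)))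
      - 1 / 2 * (t + ((n : ℝ) + 1) / (2 * n)) * (Real.log (β * n / 2) - 1)) atTop
      (𝓝 (1 / 2 * (mulLogPrimitive (t + 1) - mulLogPrimitive t))) := by
  have hR := tendsto_riemann_sum (f := fun u => u * Real.log u) (F := mulLogPrimitive) (t := t)
    Real.continuous_mul_log.continuousOn continuous_mulLogPrimitive.continuousOn
    fun x hx => hasDerivAt_mulLogPrimitive (ht.trans_lt hx.1)
  -- The Stirling remainder is `O(ln n)` in each of the `n` terms, hence negligible after division
  -- by `β n²`.
  set e : ℝ → ℝ := fun x => logGamma x - (x * Real.log x - x) with he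
  have hE : Tendsto (fun n : ℕ => 1 / (β * (n : ℝ) ^ 2) *
      ∑ j ∈ Finset.range n, e (β / 2 * (n * t + (j + 1)))) atTop (𝓝 0) := by
    have hB : Tendsto (fun n : ℕ => 1 / β * ((1 + |Real.log (β / 2)| + Real.log (t + 1)) * (1 / n)
        + Real.log n / (n : ℝ))) atTop (𝓝 0) := by
      have := ((tendsto_one_div_atTop_nhds_zero_nat (𝕜 := ℝ)).const_mul
        (1 + |Real.log (β / 2)| + Real.log (t + 1))).add tendsto_log_div_nat
      simpa using this.const_mul (1 / β)
    refine squeeze_zero_norm' ?_ hB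
    filter_upwards [eventually_ge_atTop 1] with n hn
    have hn0 : (1 : ℝ) ≤ n := by exact_mod_cast hn
    have hterm : ∀ j ∈ Finset.range n, |e (β / 2 * (n * t + (j + 1)))|
        ≤ 1 + |Real.log (β / 2)| + Real.log (t + 1) + Real.log n := by
      intro j hj
      have hjn : (j : ℝ) + 1 ≤ n := by exact_mod_cast Finset.mem_range.1 hj
      have hj0 : (0 : ℝ) ≤ j := j.cast_nonneg
      have hnt : 0 ≤ (n : ℝ) * t := by positivity
      have hy1 : 1 ≤ n * t + ((j : ℝ) + 1) := by linarith
      have hx : 0 < β / 2 * (n * t + ((j : ℝ) + 1)) := by positivity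
      have h1 := abs_logGamma_sub_le hx
      have h2 : |Real.log (β / 2 * (n * t + ((j : ℝ) + 1)))|
          ≤ |Real.log (β / 2)| + (Real.log (t + 1) + Real.log n) := by
        rw [Real.log_mul (by positivity) (by positivity)]
        refine (abs_add_le _ _).trans ?_
        rw [abs_of_nonneg (Real.log_nonneg hy1), ← Real.log_mul (by positivity) (by positivity)]
        have : n * t + ((j : ℝ) + 1) ≤ (t + 1) * n := by nlinarith
        linarith [Real.log_le_log (by linarith) this]
      have h3 : |e (β / 2 * (n * t + (j + 1)))|
          ≤ |e (β / 2 * (n * t + (j + 1))) - 1| + 1 := by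
        have := abs_add_le (e (β / 2 * (n * t + (j + 1))) - 1) 1
        simpa using this
      have h4 : |e (β / 2 * (n * t + (j + 1))) - 1|
        ≤ |Real.log (β / 2 * (n * t + ((j : ℝ) + 1)))| := h1
      linarith
    rw [Real.norm_eq_abs, abs_mul, abs_of_pos (by positivity : 0 < 1 / (β * (n : ℝ) ^ 2))]
    calc _ ≤ 1 / (β * (n : ℝ) ^ 2) * ∑ j ∈ Finset.range n,
          (1 + |Real.log (β / 2)| + Real.log (t + 1) + Real.log n) := by
          refine mul_le_mul_of_nonneg_left ?_ (by positivity)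
          exact (Finset.abs_sum_le_sum_abs _ _).trans (Finset.sum_le_sum hterm)
      _ = _ := by
          rw [Finset.sum_const, Finset.card_range, nsmul_eq_mul]
          field_simp
  have hsum := (hR.const_mul (1 / 2)).add hE
  rw [add_zero] at hsum
  refine hsum.congr' ?_
  filter_upwards [eventually_ge_atTop 1] with n hn
  have hn0 : (0 : ℝ) < n := by exact_mod_cast hn
  -- With `x = (β n / 2) u`, the main term `x ln x - x` splits into a multiple of `u ln u`, giving
  -- the Riemann sum, and a part linear in `u`, whose sum is exactly the term subtracted in the
  -- statement.
  have hdec : ∀ j ∈ Finset.range n, logGamma (β / 2 * (n * t + (j + 1)))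
      = β * n / 2 * ((t + ((j : ℝ) + 1) / n) * Real.log (t + ((j : ℝ) + 1) / n))
        + β * n / 2 * (Real.log (β * n / 2) - 1) * (t + ((j : ℝ) + 1) / n)
        + e (β / 2 * (n * t + (j + 1))) := by
    intro j _
    have hx : β / 2 * (n * t + ((j : ℝ) + 1)) = β * n / 2 * (t + ((j : ℝ) + 1) / n) := by
      field_simp
    have hu : 0 < t + ((j : ℝ) + 1) / n := by positivity
    simp only [he]
    rw [hx, Real.log_mul (by positivity) hu.ne']
    ring
  have hlin : ∑ j ∈ Finset.range n, (t + ((j : ℝ) + 1) / n) = n * t + ((n : ℝ) + 1) / 2 := by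
    have h1 : ∀ m : ℕ, ∑ j ∈ Finset.range m, ((j : ℝ) + 1) = m * (m + 1) / 2 := by
      intro m
      induction m with
      | zero => simp
      | succ m ih => rw [Finset.sum_range_succ, ih]; push_cast; ring
    rw [Finset.sum_add_distrib, ← Finset.sum_div, h1, Finset.sum_const, Finset.card_range,
      nsmul_eq_mul]
    field_simp
  rw [Finset.sum_congr rfl hdec, Finset.sum_add_distrib, Finset.sum_add_distrib, ← Finset.mul_sum,
    ← Finset.mul_sum, hlin]
  field_simp
  ring

/-- The subtracted terms for `t = c - 1` and `t = c - 1 - 2 s` differ by `s (ln (β n / 2) - 1)`. The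
logarithm cancels the one in `finiteJH`, and `-s` remains. -/
theorem tendsto_finiteJH (hβ : 0 < β) (hc : 1 ≤ c) {s : ℝ} (hs : s ≤ sc c) :
    Tendsto (fun n : ℕ => finiteJH β c n s) atTop (𝓝 (JH c s)) := by
  have hs' : s ≤ (c - 1) / 2 := hs
  have h1 := tendsto_sum_logGamma hβ (t := c - 1 - 2 * s) (by linarith)
  have h2 := tendsto_sum_logGamma hβ (t := c - 1) (by linarith)
  have h3 := (h2.sub h1).add_const (-s)
  have e : 1 / 2 * (mulLogPrimitive (c - 1 + 1) - mulLogPrimitive (c - 1))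
      - 1 / 2 * (mulLogPrimitive (c - 1 - 2 * s + 1) - mulLogPrimitive (c - 1 - 2 * s)) + -s
      = JH c s := by
    simp only [JH, phi, sc, mulLogPrimitive]
    rw [show -2 * (s - (c - 1) / 2) = c - 1 - 2 * s by ring,
      show 1 - 2 * (s - (c - 1) / 2) = c - 1 - 2 * s + 1 by ring,
      show -2 * (-((c - 1) / 2)) = c - 1 by ring,
      show 1 - 2 * (-((c - 1) / 2)) = c - 1 + 1 by ring]
    ring
  rw [e] at h3
  refine h3.congr' ?_
  filter_upwards [eventually_ge_atTop 1] with n hn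
  have hn0 : (0 : ℝ) < n := by exact_mod_cast hn
  rw [finiteJH, Finset.sum_sub_distrib]
  ring

theorem tendsto_iteratedDeriv_finiteJH (hβ : 0 < β) (hc : 1 < c) (l : ℕ) :
    Tendsto (fun n : ℕ => iteratedDeriv l (finiteJH β c n) 0) atTop
      (𝓝 (iteratedDeriv l (JH c) 0)) := by
  have h0 : (0 : ℝ) ∈ Set.Iio (sc c) := by
    simp only [sc, Set.mem_Iio]
    linarith
  have h := HigherDerivNonneg.tendsto_iteratedDeriv (f := fun n s => -finiteJH β c n s)
    (g := fun s => -JH c s) isOpen_Iio (convex_Iio (sc c))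
    (fun n => higherDerivNonneg_neg_finiteJH hβ n) (analyticOnNhd_JH c).neg
    (fun s hs => (tendsto_finiteJH hβ hc.le (le_of_lt hs)).neg) l 0 h0
  simp only [iteratedDeriv_fun_neg] at h
  simpa using h.neg

theorem analyticAt_finiteJH (hβ : 0 < β) (hc : 1 < c) (n : ℕ) :
    AnalyticAt ℝ (finiteJH β c n) 0 := by
  have h0 : (0 : ℝ) ∈ Set.Iio (sc c) := by
    simp only [sc, Set.mem_Iio]
    linarith
  simpa [Pi.neg_def] using ((higherDerivNonneg_neg_finiteJH hβ n).analytic 0 h0).neg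

theorem analyticAt_JH (hc : 1 < c) : AnalyticAt ℝ (JH c) 0 :=
  analyticOnNhd_JH c 0 (by simp only [sc, Set.mem_Iio]; linarith)

theorem analyticAt_log_one_add : AnalyticAt ℝ (fun s : ℝ => Real.log (1 + 2 * s)) 0 :=
  AnalyticAt.log (by fun_prop) (by norm_num)

theorem analyticAt_JT (c : ℝ) : AnalyticAt ℝ (JT c) 0 :=
  analyticAt_const.mul analyticAt_log_one_add

/-! ### The decomposition of the generating function of `L` -/

theorem analyticAt_correction : AnalyticAt ℝ (fun s : ℝ => s * Real.log (1 + 2 * s) - s) 0 :=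
  (analyticAt_id.mul analyticAt_log_one_add).sub analyticAt_id

theorem JL_eq (c : ℝ) :
    JL c = fun s => JT c s + JH c (-s) + (s * Real.log (1 + 2 * s) - s) := by
  ext s
  rw [JL, J]
  ring

theorem analyticAt_decomposition (c : ℝ) {h : ℝ → ℝ} (hh : AnalyticAt ℝ h 0) :
    AnalyticAt ℝ (fun s => JT c s + h (-s) + (s * Real.log (1 + 2 * s) - s)) 0 := by
  have h2 : AnalyticAt ℝ (fun s => h (-s)) 0 :=
    AnalyticAt.fun_comp (f := fun s : ℝ => -s) (by simpa using hh) (by fun_prop)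
  exact ((analyticAt_JT c).add h2).add analyticAt_correction

theorem iteratedDeriv_decomposition (c : ℝ) {h : ℝ → ℝ} (hh : AnalyticAt ℝ h 0) (l : ℕ) :
    iteratedDeriv l (fun s => JT c s + h (-s) + (s * Real.log (1 + 2 * s) - s)) 0
      = iteratedDeriv l (JT c) 0 + (-1) ^ l * iteratedDeriv l h 0
        + iteratedDeriv l (fun s : ℝ => s * Real.log (1 + 2 * s) - s) 0 := by
  have h2 : AnalyticAt ℝ (fun s => h (-s)) 0 :=
    AnalyticAt.fun_comp (f := fun s : ℝ => -s) (by simpa using hh) (by fun_prop)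
  rw [iteratedDeriv_fun_add (f := fun s => JT c s + h (-s))
      ((analyticAt_JT c).add h2).contDiffAt analyticAt_correction.contDiffAt,
    iteratedDeriv_fun_add (analyticAt_JT c).contDiffAt h2.contDiffAt, iteratedDeriv_comp_neg,
    neg_zero, smul_eq_mul]

theorem iteratedDeriv_log_one_add (m : ℕ) :
    iteratedDeriv (m + 1) (fun s : ℝ => Real.log (1 + 2 * s)) 0
      = (-1) ^ m * m.factorial * 2 ^ (m + 1) := by
  have h1 : deriv (fun s : ℝ => Real.log (1 + 2 * s)) = fun s => 2 * (2 * s + 1)⁻¹ := by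
    ext s
    have e : (fun s : ℝ => Real.log (1 + 2 * s)) = fun s => (fun y => Real.log (1 + y)) (2 * s) :=
      rfl
    rw [e, deriv_comp_mul_left 2 (fun y => Real.log (1 + y)) s, deriv_comp_const_add,
      Real.deriv_log, smul_eq_mul, add_comm]
  rw [iteratedDeriv_succ', h1, iteratedDeriv_const_mul_field, iteratedDeriv_eq_iterate,
    iter_deriv_inv_linear]
  simp only [mul_zero, zero_add, one_zpow, mul_one]
  ring

/-- In Leibniz's formula only the first derivative of the factor `s` survives at `0`, leaving `l`
times the derivative of order `l - 1` of `ln (1 + 2 s)`. This is the source of `δC_ℓ`. -/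
theorem iteratedDeriv_correction {l : ℕ} (hl : 1 ≤ l) :
    iteratedDeriv l (fun s : ℝ => s * Real.log (1 + 2 * s) - s) 0
      = (-2) ^ (l - 1) * (if 1 < l then (l.factorial : ℝ) / (1 - (l : ℝ)) else 0)
        - if l = 1 then 1 else 0 := by
  rw [iteratedDeriv_fun_sub (f := fun s : ℝ => s * Real.log (1 + 2 * s))
      (g := fun s : ℝ => s) (analyticAt_id.mul analyticAt_log_one_add).contDiffAt analyticAt_id.contDiffAt,
    iteratedDeriv_fun_id_zero, iteratedDeriv_fun_mul (f := fun s : ℝ => s) analyticAt_id.contDiffAt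
      analyticAt_log_one_add.contDiffAt]
  congr 1
  rw [Finset.sum_eq_single_of_mem 1 (Finset.mem_range.2 (by omega)) fun i _ hi => by
    rw [iteratedDeriv_fun_id_zero, if_neg hi]; ring]
  rw [iteratedDeriv_fun_id_zero, if_pos rfl, Nat.choose_one_right, mul_one]
  by_cases h1 : 1 < l
  · obtain ⟨m, rfl⟩ := Nat.exists_eq_add_of_le' h1
    rw [if_pos h1, show m + 1 + 1 - 1 = m + 1 by omega, iteratedDeriv_log_one_add,
      Nat.factorial_succ, Nat.factorial_succ]
    push_cast
    have hm : (1 : ℝ) - (m + 2) = -(m + 1) := by ring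
    rw [hm]
    field_simp
    have : (-2 : ℝ) ^ (m + 1) = (-1) ^ (m + 1) * 2 ^ (m + 1) := by rw [← mul_pow]; norm_num
    rw [this]
    ring
  · obtain rfl : l = 1 := by omega
    simp

end

/-! ### Mean, variance and fluctuations -/

section

variable {β c : ℝ}

theorem hasDerivAt_phi {x : ℝ} (hx : x < 0) :
    HasDerivAt phi (-1 + 2 * x * Real.log (-2 * x) + (1 - 2 * x) * Real.log (1 - 2 * x)) x := by
  have h1 : HasDerivAt (fun x : ℝ => Real.log (-2 * x)) (-2 / (-2 * x)) x := by
    have := ((hasDerivAt_id' x).const_mul (-2)).log (by linarith)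
    simpa using this
  have h2 : HasDerivAt (fun x : ℝ => Real.log (1 - 2 * x)) (-2 / (1 - 2 * x)) x := by
    have := (((hasDerivAt_id' x).const_mul 2).const_sub 1).log (by linarith)
    simpa using this
  have h := (((hasDerivAt_id' x).const_mul (-(3 / 2))).add (((hasDerivAt_id' x).fun_pow 2).mul h1)).sub
    ((((((hasDerivAt_id' x).const_mul 2).const_sub 1).fun_pow 2).div_const 4).mul h2)
  refine h.congr_deriv ?_
  have e1 : x ≠ 0 := hx.ne
  have e2 : 1 - 2 * x ≠ 0 := by linarith
  push_cast
  field_simp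
  ring

/-- Differentiating twice gives `φ'' x = 2 (ln (-2 x) - ln (1 - 2 x))`, evaluated at `-s_c`. -/
theorem iteratedDeriv_two_JH (hc : 1 < c) :
    iteratedDeriv 2 (JH c) 0 = 2 * (Real.log (c - 1) - Real.log c) := by
  have hneg : -sc c < 0 := by simp only [sc]; linarith
  have h1 : ∀ s, s < sc c → HasDerivAt (JH c) (-1 + 2 * (s - sc c) * Real.log (-2 * (s - sc c))
      + (1 - 2 * (s - sc c)) * Real.log (1 - 2 * (s - sc c))) s := by
    intro s hs
    have := (hasDerivAt_phi (sub_neg.2 hs)).comp_sub_const s (sc c)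
    exact this.sub_const _
  have h0 : (0 : ℝ) < sc c := by linarith
  have h2 : deriv (JH c) =ᶠ[𝓝 0] fun s => (fun x => -1 + 2 * x * Real.log (-2 * x)
      + (1 - 2 * x) * Real.log (1 - 2 * x)) (s - sc c) := by
    filter_upwards [gt_mem_nhds h0] with s hs using (h1 s hs).deriv
  rw [iteratedDeriv_succ, iteratedDeriv_one, h2.deriv_eq]
  have h3 : HasDerivAt (fun x : ℝ => -1 + 2 * x * Real.log (-2 * x)
      + (1 - 2 * x) * Real.log (1 - 2 * x))
      (2 * (Real.log (-2 * (0 - sc c)) - Real.log (1 - 2 * (0 - sc c)))) (0 - sc c) := by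
    rw [zero_sub]
    set x := -sc c
    have l1 : HasDerivAt (fun x : ℝ => Real.log (-2 * x)) (-2 / (-2 * x)) x := by
      have := ((hasDerivAt_id' x).const_mul (-2)).log (by linarith)
      simpa using this
    have l2 : HasDerivAt (fun x : ℝ => Real.log (1 - 2 * x)) (-2 / (1 - 2 * x)) x := by
      have := (((hasDerivAt_id' x).const_mul 2).const_sub 1).log (by linarith)
      simpa using this
    have h := ((((hasDerivAt_id' x).const_mul 2).mul l1).const_add (-1)).add
      ((((hasDerivAt_id' x).const_mul 2).const_sub 1).mul l2)
    refine (h.congr_deriv ?_).congr_of_eventuallyEq (Eventually.of_forall fun y => ?_)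
    · have e1 : x ≠ 0 := hneg.ne
      have e2 : 1 - 2 * x ≠ 0 := by linarith
      field_simp
      ring
    · simp only [Pi.add_apply, Pi.mul_apply]
  rw [(h3.comp_sub_const 0 (sc c)).deriv, sc]
  congr 3 <;> ring_nf

theorem iteratedDeriv_JT_one (c : ℝ) : iteratedDeriv 1 (JT c) 0 = c := by
  unfold JT
  rw [iteratedDeriv_const_mul_field, iteratedDeriv_log_one_add 0]
  simp

theorem iteratedDeriv_JT_two (c : ℝ) : iteratedDeriv 2 (JT c) 0 = -2 * c := by
  unfold JT
  rw [iteratedDeriv_const_mul_field, iteratedDeriv_log_one_add 1]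
  norm_num
  ring

theorem iteratedDeriv_two_JL (hc : 1 < c) :
    iteratedDeriv 2 (JL c) 0 = -2 * (c + Real.log (c / (c - 1)) - 2) := by
  rw [JL_eq, iteratedDeriv_decomposition c (analyticAt_JH hc), iteratedDeriv_JT_two,
    iteratedDeriv_two_JH hc, iteratedDeriv_correction (by norm_num),
    Real.log_div (by linarith) (by linarith)]
  norm_num
  ring

theorem deriv_finiteJH (hβ : 0 < β) (hc : 1 < c) {n : ℕ} (hn : 1 ≤ n) :
    HasDerivAt (finiteJH β c n) (-Real.log (β * n / 2) + 1 / n * ∑ j ∈ Finset.range n,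
      deriv logGamma (β / 2 * (n * (c - 1) + (j + 1)))) 0 := by
  have hn0 : (n : ℝ) ≠ 0 := by positivity
  have hterm : ∀ j ∈ Finset.range n, HasDerivAt
      (fun s => logGamma (β / 2 * (n * (c - 1 - 2 * s) + (j + 1)))
        - logGamma (β / 2 * (n * (c - 1) + (j + 1))))
      (deriv logGamma (β / 2 * (n * (c - 1) + (j + 1))) * (-(β * n))) 0 := by
    intro j _
    have hpos : 0 < β / 2 * (n * (c - 1 - 2 * 0) + ((j : ℝ) + 1)) := by
      have : 0 < c - 1 := by linarith
      rw [mul_zero, sub_zero]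
      positivity
    have h1 : HasDerivAt (fun s : ℝ => β / 2 * (n * (c - 1 - 2 * s) + ((j : ℝ) + 1)))
        (-(β * n)) 0 := by
      have := ((((((hasDerivAt_id' (0 : ℝ)).const_mul 2).const_sub (c - 1)).const_mul
        (n : ℝ)).add_const ((j : ℝ) + 1)).const_mul (β / 2))
      refine this.congr_deriv ?_
      ring
    have h2 := ((differentiableAt_logGamma hpos).hasDerivAt.comp 0 h1).sub_const
      (logGamma (β / 2 * (n * (c - 1) + (j + 1))))
    rw [mul_zero, sub_zero] at h2
    exact h2
  have h := ((hasDerivAt_neg (0 : ℝ)).mul_const (Real.log (β * n / 2))).sub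
    ((HasDerivAt.fun_sum hterm).const_mul (1 / (β * (n : ℝ) ^ 2)))
  refine h.congr_deriv ?_
  rw [← Finset.sum_mul]
  field_simp
  ring

/-- Riemann sums of the logarithm converge at rate `1 / n`. -/
theorem abs_sum_log_sub_le {t : ℝ} (ht : 0 < t) {n : ℕ} (hn : 1 ≤ n) :
    |1 / n * ∑ j ∈ Finset.range n, Real.log (t + ((j : ℝ) + 1) / n)
      - ((t + 1) * Real.log (t + 1) - t * Real.log t - 1)|
      ≤ (Real.log (t + 1) - Real.log t) / n := by
  have hn0 : (0 : ℝ) < n := by exact_mod_cast hn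
  set p : ℕ → ℝ := fun j => t + (j : ℝ) / n with hp
  set P : ℝ → ℝ := fun u => u * Real.log u - u with hP
  have hppos : ∀ j, 0 < p j := fun j => by simp only [hp]; positivity
  have e : ∀ j, p (j + 1) = p j + 1 / n := fun j => by simp only [hp]; push_cast; ring
  have hder : ∀ u, 0 < u → HasDerivAt P (Real.log u) u := by
    intro u hu
    have := (Real.hasDerivAt_mul_log hu.ne').sub (hasDerivAt_id' u)
    exact this.congr_deriv (by ring)
  -- Since `ln` increases, the integral over each cell lies between the left and right endpoint
  -- sums; their differences telescope to the stated error.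
  have hstep : ∀ j, Real.log (p j) * (1 / n) ≤ P (p (j + 1)) - P (p j) ∧
      P (p (j + 1)) - P (p j) ≤ Real.log (p (j + 1)) * (1 / n) := by
    intro j
    have hpos : 0 < 1 / (n : ℝ) := by positivity
    obtain ⟨ξ, hξ, hξ'⟩ := exists_hasDerivAt_eq_slope P Real.log (a := p j) (b := p (j + 1))
      (by linarith [e j])
      (fun x hx => (hder x ((hppos j).trans_le hx.1)).continuousAt.continuousWithinAt)
      (fun x hx => hder x ((hppos j).trans hx.1))
    rw [e j, add_sub_cancel_left, eq_div_iff hpos.ne', ← e j] at hξ'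
    rw [← hξ']
    exact ⟨mul_le_mul_of_nonneg_right (Real.log_le_log (hppos j) hξ.1.le) hpos.le,
      mul_le_mul_of_nonneg_right (Real.log_le_log ((hppos j).trans hξ.1) hξ.2.le) hpos.le⟩
  have tel : (t + 1) * Real.log (t + 1) - t * Real.log t - 1
      = ∑ j ∈ Finset.range n, (P (p (j + 1)) - P (p j)) := by
    rw [Finset.sum_range_sub (fun j => P (p j))]
    simp only [hp, hP, div_self hn0.ne', Nat.cast_zero, zero_div, add_zero]
    ring
  have tel2 : (Real.log (t + 1) - Real.log t) / n
      = ∑ j ∈ Finset.range n, (Real.log (p (j + 1)) * (1 / n) - Real.log (p j) * (1 / n)) := by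
    rw [Finset.sum_range_sub (fun j => Real.log (p j) * (1 / n))]
    simp only [hp, div_self hn0.ne', Nat.cast_zero, zero_div, add_zero]
    ring
  have e3 : ∀ j : ℕ, t + ((j : ℝ) + 1) / n = p (j + 1) := fun j => by simp [hp]
  rw [tel, tel2, Finset.mul_sum, ← Finset.sum_sub_distrib]
  refine (Finset.abs_sum_le_sum_abs _ _).trans (Finset.sum_le_sum fun j _ => ?_)
  rw [e3, mul_comm (1 / (n : ℝ)), abs_of_nonneg (by linarith [(hstep j).2])]
  linarith [(hstep j).1]

/-- An exact mean is needed because convergence of the generating functions alone gives no rate. -/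
theorem integral_likelihoodRatio (hβ : 0 < β) (hc : 1 < c) {n : ℕ} (hn : 1 ≤ n) :
    ∫ x, likelihoodRatio n x ∂law β c n
      = c - 1 + Real.log (β * n / 2) - 1 / n * ∑ j ∈ Finset.range n,
        deriv logGamma (β / 2 * (n * (c - 1) + (j + 1))) := by
  have := isProbabilityMeasure_law hβ hc.le hn
  have h1 := deriv_cgf_zero (zero_mem_interior_likelihoodRatio hβ hc hn)
  rw [probReal_univ, div_one] at h1
  have h2 := pow_mul_iteratedDeriv_of_eventuallyEq (by positivity)
    (cgf_likelihoodRatio hβ hc hn) le_rfl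
  rw [Nat.sub_self, pow_zero, one_mul, iteratedDeriv_one, h1] at h2
  rw [h2]
  unfold finiteJL
  rw [iteratedDeriv_decomposition c (analyticAt_finiteJH hβ hc n), iteratedDeriv_JT_one,
    iteratedDeriv_correction le_rfl, iteratedDeriv_one, (deriv_finiteJH hβ hc hn).deriv]
  norm_num
  ring

/-- The mean of `L` converges at rate `1 / n`. -/
theorem exists_abs_integral_sub_le (hβ : 0 < β) (hc : 1 < c) :
    ∃ K : ℝ, ∀ n : ℕ, 1 ≤ n → |∫ x, likelihoodRatio n x ∂law β c n - meanL c| ≤ K / n := by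
  have ht : 0 < c - 1 := by linarith
  -- The first term is the Riemann sum error for `ln`; the second bounds the digamma error `1 / x`,
  -- every argument satisfying `x ≥ β / 2 * n (c - 1)`.
  refine ⟨(Real.log (c - 1 + 1) - Real.log (c - 1)) + 1 / (β / 2 * (c - 1)), fun n hn => ?_⟩
  have hn0 : (0 : ℝ) < n := by exact_mod_cast hn
  have h1 := abs_sum_log_sub_le ht hn
  have hterm : ∀ j ∈ Finset.range n,
      |deriv logGamma (β / 2 * (n * (c - 1) + (j + 1)))
        - (Real.log (β * n / 2) + Real.log (c - 1 + ((j : ℝ) + 1) / n))|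
      ≤ 1 / (β / 2 * (c - 1)) / n := by
    intro j _
    have hx : β / 2 * (n * (c - 1) + ((j : ℝ) + 1)) = β * n / 2 * (c - 1 + ((j : ℝ) + 1) / n) := by
      field_simp
    have hpos : 0 < β / 2 * (n * (c - 1) + ((j : ℝ) + 1)) := by positivity
    rw [← Real.log_mul (by positivity) (by positivity), ← hx]
    have h2 := deriv_logGamma_le hpos
    have h3 := le_deriv_logGamma hpos
    have h4 : 1 / (β / 2 * (n * (c - 1) + ((j : ℝ) + 1))) ≤ 1 / (β / 2 * (c - 1)) / n := by
      rw [div_div]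
      refine one_div_le_one_div_of_le (by positivity) ?_
      have : (0 : ℝ) ≤ j := j.cast_nonneg
      have : 0 ≤ β / 2 * ((j : ℝ) + 1) := by positivity
      linarith
    rw [abs_sub_comm, abs_of_nonneg (by linarith)]
    linarith
  have h5 : |1 / n * ∑ j ∈ Finset.range n, deriv logGamma (β / 2 * (n * (c - 1) + (j + 1)))
      - (Real.log (β * n / 2)
        + 1 / n * ∑ j ∈ Finset.range n, Real.log (c - 1 + ((j : ℝ) + 1) / n))|
      ≤ 1 / (β / 2 * (c - 1)) / n := by
    have e : 1 / n * ∑ j ∈ Finset.range n, deriv logGamma (β / 2 * (n * (c - 1) + (j + 1)))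
      - (Real.log (β * n / 2)
        + 1 / n * ∑ j ∈ Finset.range n, Real.log (c - 1 + ((j : ℝ) + 1) / n))
      = 1 / n * ∑ j ∈ Finset.range n, (deriv logGamma (β / 2 * (n * (c - 1) + (j + 1)))
        - (Real.log (β * n / 2) + Real.log (c - 1 + ((j : ℝ) + 1) / n))) := by
      rw [Finset.sum_sub_distrib, Finset.sum_add_distrib, Finset.sum_const, Finset.card_range,
        nsmul_eq_mul]
      field_simp
    rw [e, abs_mul, abs_of_pos (by positivity : 0 < 1 / (n : ℝ))]
    calc _ ≤ 1 / (n : ℝ) * ∑ j ∈ Finset.range n, 1 / (β / 2 * (c - 1)) / n := by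
          refine mul_le_mul_of_nonneg_left ?_ (by positivity)
          exact (Finset.abs_sum_le_sum_abs _ _).trans (Finset.sum_le_sum hterm)
      _ = _ := by
          rw [Finset.sum_const, Finset.card_range, nsmul_eq_mul]
          field_simp
  rw [integral_likelihoodRatio hβ hc hn, meanL, add_div]
  rw [abs_le] at h1 h5 ⊢
  have e1 : c - 1 + 1 = c := by ring
  rw [e1] at h1 ⊢
  constructor <;> linarith [h1.1, h1.2, h5.1, h5.2]

theorem variance_likelihoodRatio (hβ : 0 < β) (hc : 1 < c) {n : ℕ} (hn : 1 ≤ n) :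
    Var[likelihoodRatio n; law β c n] = cumulant 2 (likelihoodRatio n) (law β c n) := by
  have hmem := zero_mem_interior_likelihoodRatio hβ hc hn
  have := isProbabilityMeasure_law hβ hc.le hn
  rw [cumulant, iteratedDeriv_two_cgf_eq_integral hmem, deriv_cgf_zero hmem,
    variance_eq_integral (aemeasurable_of_mem_interior_integrableExpSet hmem)]
  simp

theorem cumulant_likelihoodRatio (hβ : 0 < β) (hc : 1 < c) {n : ℕ} (hn : 1 ≤ n) {l : ℕ}
    (hl : 1 ≤ l) :
    (-(β * (n : ℝ) ^ 2)) ^ (l - 1) * cumulant l (likelihoodRatio n) (law β c n)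
      = iteratedDeriv l (JT c) 0 + (-1) ^ l * iteratedDeriv l (finiteJH β c n) 0
        + iteratedDeriv l (fun s : ℝ => s * Real.log (1 + 2 * s) - s) 0 := by
  rw [cumulant, pow_mul_iteratedDeriv_of_eventuallyEq (by positivity)
    (cgf_likelihoodRatio hβ hc hn) hl]
  exact iteratedDeriv_decomposition c (analyticAt_finiteJH hβ hc n) l

theorem cumulant_totalVar (hβ : 0 < β) (hc : 1 < c) {n : ℕ} (hn : 1 ≤ n) {l : ℕ} (hl : 1 ≤ l) :
    (-(β * (n : ℝ) ^ 2)) ^ (l - 1) * cumulant l (totalVar n) (law β c n)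
      = iteratedDeriv l (JT c) 0 :=
  pow_mul_iteratedDeriv_of_eventuallyEq (by positivity) (cgf_totalVar hβ hc hn) hl

theorem cumulant_logDet (hβ : 0 < β) (hc : 1 < c) {n : ℕ} (hn : 1 ≤ n) {l : ℕ} (hl : 1 ≤ l) :
    (-(β * (n : ℝ) ^ 2)) ^ (l - 1) * cumulant l (logDet n) (law β c n)
      = iteratedDeriv l (finiteJH β c n) 0 :=
  pow_mul_iteratedDeriv_of_eventuallyEq (by positivity) (cgf_logDet hβ hc hn) hl

theorem tendsto_cumulant_likelihoodRatio (hβ : 0 < β) (hc : 1 < c) {l : ℕ} (hl : 1 ≤ l) :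
    Tendsto (fun n : ℕ => (-(β * (n : ℝ) ^ 2)) ^ (l - 1) *
      cumulant l (likelihoodRatio n) (law β c n)) atTop (𝓝 (iteratedDeriv l (JL c) 0)) := by
  rw [JL_eq, iteratedDeriv_decomposition c (analyticAt_JH hc)]
  refine (((tendsto_iteratedDeriv_finiteJH hβ hc l).const_mul ((-1) ^ l)).const_add
    (iteratedDeriv l (JT c) 0)).add_const _ |>.congr' ?_
  filter_upwards [eventually_ge_atTop 1] with n hn
  rw [cumulant_likelihoodRatio hβ hc hn hl]

/-- The decomposition of the cumulants of `L` is exact at finite `n`. -/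
theorem cumulant_likelihoodRatio_eq (hβ : 0 < β) (hc : 1 < c) {n : ℕ} (hn : 1 ≤ n) {l : ℕ}
    (hl : 1 ≤ l) :
    cumulant l (likelihoodRatio n) (law β c n) = cumulant l (totalVar n) (law β c n)
      + (-1) ^ l * cumulant l (logDet n) (law β c n) + deltaC β n l := by
  have hN : (-(β * (n : ℝ) ^ 2)) ^ (l - 1) ≠ 0 := pow_ne_zero _ (neg_ne_zero.2 (by positivity))
  refine mul_left_cancel₀ hN ?_
  rw [cumulant_likelihoodRatio hβ hc hn hl, mul_add, mul_add, mul_left_comm,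
    cumulant_totalVar hβ hc hn hl, cumulant_logDet hβ hc hn hl, iteratedDeriv_correction hl,
    deltaC, omega, mul_sub, ← mul_assoc (_ ^ (l - 1)), ← mul_pow]
  -- The normalization times `ω_β(n, ℓ)` is `(-2) ^ (ℓ - 1)`, the factor in the derivative of the
  -- correction.
  have e : -(β * (n : ℝ) ^ 2) * (2 / (β * (n : ℝ) ^ 2)) = -2 := by field_simp
  rw [e]
  congr 2
  by_cases h : l = 1
  · subst h; simp
  · simp [h]

theorem tendsto_variance (hβ : 0 < β) (hc : 1 < c) :
    Tendsto (fun n : ℕ => Var[likelihoodRatio n; law β c n] / omega β n 2) atTop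
      (𝓝 (c + Real.log (c / (c - 1)) - 2)) := by
  -- The factor `-1/2` converts `-β n²` into `1 / ω_β(n, 2)`.
  have h := (tendsto_cumulant_likelihoodRatio hβ hc (l := 2) (by norm_num)).const_mul (-(1 / 2))
  rw [iteratedDeriv_two_JL hc] at h
  have e : -(1 / 2) * (-2 * (c + Real.log (c / (c - 1)) - 2)) = c + Real.log (c / (c - 1)) - 2 := by
    ring
  rw [e] at h
  refine h.congr' ?_
  filter_upwards [eventually_ge_atTop 1] with n hn
  have hn0 : (n : ℝ) ≠ 0 := by positivity
  rw [variance_likelihoodRatio hβ hc hn, omega]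
  norm_num
  field_simp

theorem memLp_likelihoodRatio (hβ : 0 < β) (hc : 1 < c) {n : ℕ} (hn : 1 ≤ n) :
    MemLp (likelihoodRatio n) 2 (law β c n) := by
  have := memLp_of_mem_interior_integrableExpSet (zero_mem_interior_likelihoodRatio hβ hc hn) 2
  simpa using this

/-- The fluctuations of `L` around its limiting mean are of order `1 / n`. -/
theorem exists_fluctuation_bound (hβ : 0 < β) (hc : 1 < c) {ε : ℝ} (hε : 0 < ε) :
    ∃ K : ℝ, ∀ n : ℕ, 1 ≤ n →
      (law β c n).real {x | K / (n : ℝ) < |likelihoodRatio n x - meanL c|} ≤ ε := by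
  obtain ⟨K, hK⟩ := exists_abs_integral_sub_le hβ hc
  obtain ⟨V, hV⟩ := (tendsto_variance hβ hc).bddAbove_range
  have hV' : ∀ n : ℕ, 1 ≤ n → Var[likelihoodRatio n; law β c n] ≤ |V| * (2 / β) / (n : ℝ) ^ 2 := by
    intro n hn
    have hn0 : (0 : ℝ) < n := by exact_mod_cast hn
    have h : Var[likelihoodRatio n; law β c n] / omega β n 2 ≤ V := hV ⟨n, rfl⟩
    rw [div_le_iff₀ (by rw [omega]; positivity)] at h
    refine h.trans ((mul_le_mul_of_nonneg_right (le_abs_self V)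
      (by rw [omega]; positivity)).trans_eq ?_)
    rw [omega]
    norm_num
    field_simp
  -- Chebyshev requires `|V| (2 / β) ≤ ε R²`; the `+ 1` ensures `R ≥ 1`, so that `R ≤ R²`. The final
  -- constant adds `K`, which covers the bias of the mean.
  set R : ℝ := |V| * (2 / β) / ε + 1 with hR
  have hR1 : 1 ≤ R := by
    have : 0 ≤ |V| * (2 / β) / ε := by positivity
    linarith
  refine ⟨K + R, fun n hn => ?_⟩
  have := isProbabilityMeasure_law hβ hc.le hn
  have hn0 : (0 : ℝ) < n := by exact_mod_cast hn
  have hRn : 0 < R / n := by positivity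
  have hcheb := meas_ge_le_variance_div_sq (memLp_likelihoodRatio hβ hc hn) hRn
  have hsub : {x | (K + R) / (n : ℝ) < |likelihoodRatio n x - meanL c|}
      ⊆ {x | R / n ≤ |likelihoodRatio n x - ∫ x, likelihoodRatio n x ∂law β c n|} := by
    intro x hx
    have hx : (K + R) / (n : ℝ) < |likelihoodRatio n x - meanL c| := hx
    have h1 := abs_sub_le (likelihoodRatio n x) (∫ x, likelihoodRatio n x ∂law β c n) (meanL c)
    have h2 := hK n hn
    rw [add_div] at hx
    change R / n ≤ _
    linarith
  refine ENNReal.toReal_le_of_le_ofReal hε.le ((measure_mono hsub).trans (hcheb.trans ?_))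
  refine ENNReal.ofReal_le_ofReal ?_
  rw [div_le_iff₀ (by positivity)]
  refine (hV' n hn).trans ?_
  rw [div_pow, ← mul_div_assoc ε]
  have h3 : |V| * (2 / β) ≤ ε * R := by
    have h4 : ε * (|V| * (2 / β) / ε) = |V| * (2 / β) := by field_simp
    rw [hR, mul_add, h4]
    linarith
  have h5 : |V| * (2 / β) ≤ ε * R ^ 2 :=
    h3.trans (mul_le_mul_of_nonneg_left (by nlinarith) hε.le)
  exact div_le_div_of_nonneg_right h5 (sq_nonneg (n : ℝ))

end

end Wishart

end

/-! ### Assembly of the theorem -/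

theorem theorem2 (β c : ℝ) (hβ : 0 < β) (hc : 1 ≤ c) :
    -- the law of the eigenvalues is well defined
    (∀ n : ℕ, 1 ≤ n → IsProbabilityMeasure (Wishart.law β c n)) ∧
    -- the cumulant generating function of `L`
    (∀ s : ℝ, -(1 / 2) < s → -Wishart.sc c ≤ s →
      (∀ n : ℕ, 1 ≤ n →
        Integrable (fun x => Real.exp (-(β * (n : ℝ) ^ 2 * s * Wishart.likelihoodRatio n x)))
          (Wishart.law β c n)) ∧
      Tendsto
        (fun n : ℕ => -(1 / (β * (n : ℝ) ^ 2)) * Real.log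
          (∫ x, Real.exp (-(β * (n : ℝ) ^ 2 * s * Wishart.likelihoodRatio n x))
            ∂(Wishart.law β c n)))
        atTop (𝓝 (Wishart.J c (-s) s - s))) ∧
    (1 < c →
      -- the cumulants at leading order, by differentiation of the generating functions
      (AnalyticAt ℝ (Wishart.JL c) 0 ∧ AnalyticAt ℝ (Wishart.JT c) 0 ∧
        AnalyticAt ℝ (Wishart.JH c) 0) ∧
      (∀ n : ℕ, 1 ≤ n →
        AnalyticAt ℝ (cgf (Wishart.likelihoodRatio n) (Wishart.law β c n)) 0 ∧
        AnalyticAt ℝ (cgf (Wishart.totalVar n) (Wishart.law β c n)) 0 ∧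
        AnalyticAt ℝ (cgf (Wishart.logDet n) (Wishart.law β c n)) 0) ∧
      (∀ ℓ : ℕ, 1 ≤ ℓ →
        Tendsto
          (fun n : ℕ => (-(β * (n : ℝ) ^ 2)) ^ (ℓ - 1) *
            Wishart.cumulant ℓ (Wishart.likelihoodRatio n) (Wishart.law β c n))
          atTop (𝓝 (iteratedDeriv ℓ (Wishart.JL c) 0)) ∧
        Tendsto
          (fun n : ℕ => (-(β * (n : ℝ) ^ 2)) ^ (ℓ - 1) *
            Wishart.cumulant ℓ (Wishart.totalVar n) (Wishart.law β c n))
          atTop (𝓝 (iteratedDeriv ℓ (Wishart.JT c) 0)) ∧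
        Tendsto
          (fun n : ℕ => (-(β * (n : ℝ) ^ 2)) ^ (ℓ - 1) *
            Wishart.cumulant ℓ (Wishart.logDet n) (Wishart.law β c n))
          atTop (𝓝 (iteratedDeriv ℓ (Wishart.JH c) 0)) ∧
        Tendsto
          (fun n : ℕ =>
            (Wishart.cumulant ℓ (Wishart.likelihoodRatio n) (Wishart.law β c n)
              - (Wishart.cumulant ℓ (Wishart.totalVar n) (Wishart.law β c n)
                + (-1) ^ ℓ * Wishart.cumulant ℓ (Wishart.logDet n) (Wishart.law β c n)
                + Wishart.deltaC β n ℓ)) / Wishart.omega β n ℓ)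
          atTop (𝓝 0)) ∧
      -- the mean, with fluctuations of order `1/n` around it, and the variance
      (∀ n : ℕ, 1 ≤ n → MemLp (Wishart.likelihoodRatio n) 2 (Wishart.law β c n)) ∧
      Tendsto (fun n : ℕ => ∫ x, Wishart.likelihoodRatio n x ∂(Wishart.law β c n))
        atTop (𝓝 (Wishart.meanL c)) ∧
      (∀ ε : ℝ, 0 < ε → ∃ K : ℝ, ∀ n : ℕ, 1 ≤ n →
        (Wishart.law β c n).real
          {x | K / (n : ℝ) < |Wishart.likelihoodRatio n x - Wishart.meanL c|} ≤ ε) ∧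
      Tendsto
        (fun n : ℕ => Var[Wishart.likelihoodRatio n; Wishart.law β c n] / Wishart.omega β n 2)
        atTop (𝓝 (c + Real.log (c / (c - 1)) - 2))) := by
  refine ⟨fun n hn => Wishart.isProbabilityMeasure_law hβ hc hn, fun s hs hs' => ?_, fun hc => ?_⟩
  · have hsc : 0 ≤ c - 1 + 2 * s := by
      rw [Wishart.sc] at hs'
      linarith
    -- The endpoint `s = -s_c` is admissible because of the `+ 1`.
    have hdom : ∀ n : ℕ, 0 < (n : ℝ) * (c - 1 + 2 * s) + 1 := fun n => by positivity
    refine ⟨fun n hn => Wishart.integrable_exp_likelihoodRatio hβ hc hn (hdom n) hs, ?_⟩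
    have hlim := ((Wishart.tendsto_finiteJH hβ hc (s := -s) (by linarith)).const_add
      (Wishart.JT c s)).add_const (s * Real.log (1 + 2 * s) - s)
    have hJ : Wishart.JT c s + Wishart.JH c (-s) + (s * Real.log (1 + 2 * s) - s)
        = Wishart.J c (-s) s - s := by
      rw [Wishart.J]
      ring
    rw [hJ] at hlim
    refine hlim.congr' ?_
    filter_upwards [eventually_ge_atTop 1] with n hn
    have hn0 : (n : ℝ) ≠ 0 := by positivity
    rw [Wishart.log_integral_exp_likelihoodRatio hβ hc hn (hdom n) hs, Wishart.finiteJL]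
    field_simp
  · refine ⟨⟨?_, Wishart.analyticAt_JT c, Wishart.analyticAt_JH hc⟩, fun n hn =>
      ⟨analyticAt_cgf (Wishart.zero_mem_interior_likelihoodRatio hβ hc hn),
        analyticAt_cgf (Wishart.zero_mem_interior_totalVar hβ hc hn),
        analyticAt_cgf (Wishart.zero_mem_interior_logDet hβ hc hn)⟩,
      fun l hl => ⟨Wishart.tendsto_cumulant_likelihoodRatio hβ hc hl, ?_, ?_, ?_⟩,
      fun n hn => Wishart.memLp_likelihoodRatio hβ hc hn, ?_,
      fun ε hε => Wishart.exists_fluctuation_bound hβ hc hε, Wishart.tendsto_variance hβ hc⟩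
    · rw [Wishart.JL_eq]
      exact Wishart.analyticAt_decomposition c (Wishart.analyticAt_JH hc)
    · refine tendsto_const_nhds.congr' ?_
      filter_upwards [eventually_ge_atTop 1] with n hn
      rw [Wishart.cumulant_totalVar hβ hc hn hl]
    · refine (Wishart.tendsto_iteratedDeriv_finiteJH hβ hc l).congr' ?_
      filter_upwards [eventually_ge_atTop 1] with n hn
      rw [Wishart.cumulant_logDet hβ hc hn hl]
    -- The error term vanishes identically for `n ≥ 1`, the decomposition being exact.
    · refine tendsto_const_nhds.congr' ?_
      filter_upwards [eventually_ge_atTop 1] with n hn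
      rw [Wishart.cumulant_likelihoodRatio_eq hβ hc hn hl, sub_self, zero_div]
    · obtain ⟨K, hK⟩ := Wishart.exists_abs_integral_sub_le hβ hc
      rw [tendsto_iff_norm_sub_tendsto_zero]
      refine squeeze_zero' (Eventually.of_forall fun n => norm_nonneg _) ?_
        (tendsto_const_div_atTop_nhds_zero_nat K)
      filter_upwards [eventually_ge_atTop 1] with n hn using hK n hn
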